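/- Let $n_1,n_2\ge 1$, $N=n_1+n_2$, and write $x=(x_1,x_2)\in\mathbb R^N=\mathbb R^{n_1}\times\mathbb R^{n_2}$, with the Euclidean norm $|\cdot|$. **Singular integrals of fundamental type.** A singular kernel of fundamental type on $\mathbb R^{d}$ is a (complex-valued) tempered distribution $K\in\mathcal S'(\mathbb R^{d})$ with $\widehat K\in L^\infty(\mathbb R^{d})$ whose restriction to $\mathbb R^{d}\setminus\{0\}$ is a $C^1$ function satisfying, for some constants $C_0,C_1,A_1\ge 0$, $|K(x)|\le C_0|x|^{-d}$ and $|\nabla K(x)|\le C_1|x|^{-d-1}$ for $x\ne 0$, and $\bigl|\int_{R_1<|x|<R_2}K(x)\,dx\bigr|\le A_1$ for all $0<R_1<R_2<\infty$. For a finite signed measure $g$ on $\mathbb R^{d}$, the associated singular integral $Rg\in\mathcal S'(\mathbb R^{d})$ is defined by $\langle Rg,\varphi\rangle=\int_{\mathbb R^{d}}\langle K,\varphi(x+\cdot)\rangle\,dg(x)$ for $\varphi\in\mathcal S(\mathbb R^{d})$. **Tensor-product smooth maximal function.** For families $\{a^\nu\}_\nu\subset C_c^\infty(\mathbb R^{n_1})$,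 $\{b^\nu\}_\nu\subset C_c^\infty(\mathbb R^{n_2})$ with the same index set, a distribution $u\in\mathcal S'(\mathbb R^N)$ and $x\in\mathbb R^N$, put $$M_{\{a^\nu\otimes b^\nu\}}u(x)=\sup_{\varepsilon>0}\sup_\nu\Bigl|\Bigl\langle u,\ y\mapsto \varepsilon^{-N}\,a^\nu\Bigl(\frac{x_1-y_1}{\varepsilon}\Bigr)\,b^\nu\Bigl(\frac{x_2-y_2}{\varepsilon}\Bigr)\Bigr\rangle\Bigr|\in[0,\infty].$$ **The families $\Upsilon,\bar\Upsilon$.** Fix any real-valued $h^i\in C_c^\infty(\mathbb R^{n_i})$ with $\int_{\mathbb R^{n_i}} h^i=1$, $i=1,2$. For $\xi=(\xi_1,\xi_2)\in\mathbb S^{N-1}$ and $1\le j\le N$ let $$\Upsilon^{\xi,j}(w_1)=h^1\bigl(\tfrac{\xi_1}{2}-w_1\bigr)\{w_1\}^j,\qquad \bar\Upsilon^{\xi,j}(w_2)=h^2\bigl(\tfrac{\xi_2}{2}-w_2\bigr)\{w_2\}^j,$$ where $\{w_1\}^j$ is the $j$-th coordinate of $(w_1,1,\dots,1)\in\mathbb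 R^N$ and $\{w_2\}^j$ is the $j$-th coordinate of $(1,\dots,1,w_2)\in\mathbb R^N$. **Lemma.** Let $f\in L^1_{\rm loc}(\mathbb R^N)$ be real-valued and suppose that for each $j=1,\dots,N$, in the sense of distributions, $$\partial_j f=\sum_{k=1}^m (R_{jk}g_{jk})(x_1)\,\gamma_{jk}(x_2),$$ where $R_{jk}$ are singular integral operators on $\mathbb R^{n_1}$ with singular kernels $K_{jk}$ of fundamental type, $g_{jk}$ are finite signed measures on $\mathbb R^{n_1}$, and $\gamma_{jk}\in L^q(\mathbb R^{n_2})$ are real-valued, for some $q\in(1,\infty]$; the product is the tensor product of distributions. Let $\delta_1,\delta_2>0$ and $A=\mathrm{Diag}(\delta_1,\dots,\delta_1,\delta_2,\dots,\delta_2)$ ($n_1$ entries $\delta_1$, $n_2$ entries $\delta_2$). Let $R^{\delta_1}_{jk}$ be the singular integral operator with kernel $K_{jk}^{\delta_1}(x_1)=\delta_1^{n_1}K_{jk}(\delta_1x_1)$, i.e. $\langle K_{jk}^{\delta_1},\varphi\rangle=\langle K_{jk},\varphi(\cdot/\delta_1)\rangle$; let $\check g_{jk}$ be the measure with $\langle\check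 g_{jk},\varphi\rangle=\delta_1^{-n_1}\langle g_{jk},\varphi(\cdot/\delta_1)\rangle$, and let $\check\gamma_{jk}(x_2)=\gamma_{jk}(\delta_2x_2)$. Then there exist a function $U:\mathbb R^N\to[0,\infty)$ and a Lebesgue-negligible set $\mathcal N\subset\mathbb R^N$ such that for every $x\in\mathbb R^N\setminus\mathcal N$ $$U(x)=\sum_{j=1}^N\sum_{k=1}^m\Bigl[M_{\{\Upsilon^{\xi,j}\otimes\bar\Upsilon^{\xi,j}\,:\,\xi\in\mathbb S^{N-1}\}}\bigl(A_{jj}\,(R^{\delta_1}_{jk}\check g_{jk})\,\check\gamma_{jk}\bigr)\Bigr](A^{-1}x)$$ (in particular the right-hand side is finite there), and for every $x,y\in\mathbb R^N\setminus\mathcal N$ $$|f(x)-f(y)|\le |A^{-1}(x-y)|\,\bigl(U(x)+U(y)\bigr).$$ -/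

import Mathlib

open MeasureTheory TopologicalSpace
open scoped ENNReal ContDiff SchwartzMap FourierTransform Distributions

noncomputable section

namespace AnisotropicDQ

/-- `ℝ^ι` with its Euclidean norm. -/
abbrev Eu (ι : Type*) := EuclideanSpace ℝ ι

/-- `ℝ^N = ℝ^{n₁} × ℝ^{n₂}` with the Euclidean norm; `Sum.inl i` are the first `n₁` coordinates,
`Sum.inr i` are the last `n₂` coordinates. -/
abbrev EuSum (n₁ n₂ : ℕ) := EuclideanSpace ℝ (Fin n₁ ⊕ Fin n₂)

variable {n₁ n₂ : ℕ}

/-- The component `x₁ ∈ ℝ^{n₁}` of `x = (x₁, x₂)`. -/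
def fstPart (x : EuSum n₁ n₂) : Eu (Fin n₁) := WithLp.toLp 2 fun i => x (Sum.inl i)

/-- The component `x₂ ∈ ℝ^{n₂}` of `x = (x₁, x₂)`. -/
def sndPart (x : EuSum n₁ n₂) : Eu (Fin n₂) := WithLp.toLp 2 fun i => x (Sum.inr i)

/-- The point `(x₁, x₂)`. -/
def pairPt (x₁ : Eu (Fin n₁)) (x₂ : Eu (Fin n₂)) : EuSum n₁ n₂ :=
  WithLp.toLp 2 (Sum.elim (fun i => x₁ i) (fun i => x₂ i))

lemma contDiff_fstPart {k : WithTop ℕ∞} : ContDiff ℝ k (fstPart (n₁ := n₁) (n₂ := n₂)) := by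
  unfold fstPart; fun_prop

lemma contDiff_sndPart {k : WithTop ℕ∞} : ContDiff ℝ k (sndPart (n₁ := n₁) (n₂ := n₂)) := by
  unfold sndPart; fun_prop

lemma continuous_pairPt :
    Continuous fun p : Eu (Fin n₁) × Eu (Fin n₂) => pairPt p.1 p.2 := by
  unfold pairPt
  refine (PiLp.continuous_toLp 2 _).comp (continuous_pi fun i => ?_)
  rcases i with i | i <;> simp <;> fun_prop

lemma pairPt_fst_snd (x : EuSum n₁ n₂) : pairPt (fstPart x) (sndPart x) = x := by
  ext i; rcases i with i | i <;> rfl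

lemma norm_pairPt_sub (x₁ y₁ : Eu (Fin n₁)) (x₂ : Eu (Fin n₂)) :
    ‖pairPt x₁ x₂ - pairPt y₁ x₂‖ = ‖x₁ - y₁‖ := by
  simp [EuclideanSpace.norm_eq, pairPt]

lemma pairPt_temperate (x₂ : Eu (Fin n₂)) :
    (fun x₁ : Eu (Fin n₁) => pairPt x₁ x₂).HasTemperateGrowth := by
  have h : (fun x₁ : Eu (Fin n₁) => pairPt x₁ x₂) =
      fun x₁ => (LinearMap.toContinuousLinearMap
        ({ toFun := fun y : Eu (Fin n₁) => (pairPt y 0 : EuSum n₁ n₂)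
           map_add' := fun a b => by ext i; rcases i with i | i <;> simp [pairPt]
           map_smul' := fun c a => by ext i; rcases i with i | i <;> simp [pairPt] } :
          Eu (Fin n₁) →ₗ[ℝ] EuSum n₁ n₂)) x₁ + pairPt 0 x₂ := by
    funext x₁; ext i; rcases i with i | i <;> simp [pairPt]
  rw [h]
  fun_prop

/-! ### Operations on Schwartz functions -/

/-- The translate `φ(x + ·)`. -/
def shiftBy {ι : Type*} [Fintype ι] (x : Eu ι) (φ : 𝓢(Eu ι, ℂ)) : 𝓢(Eu ι, ℂ) :=
  SchwartzMap.compSubConstCLM ℂ (-x) φ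

/-- The dilate `φ(· / δ)`, as a continuous linear map on the Schwartz space. -/
def divDilate {ι : Type*} [Fintype ι] (δ : ℝ) (hδ : 0 < δ) : 𝓢(Eu ι, ℂ) →L[ℂ] 𝓢(Eu ι, ℂ) :=
  SchwartzMap.compCLMOfContinuousLinearEquiv ℂ
    (ContinuousLinearEquiv.smulLeft (Units.mk0 δ⁻¹ (inv_ne_zero hδ.ne')))

/-- The slice `φ(·, x₂)`. -/
def slice (x₂ : Eu (Fin n₂)) (φ : 𝓢(EuSum n₁ n₂, ℂ)) : 𝓢(Eu (Fin n₁), ℂ) :=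
  SchwartzMap.compCLMOfAntilipschitz (K := 1) ℂ (pairPt_temperate x₂)
    (AntilipschitzWith.of_le_mul_dist fun a b => by
      simp [dist_eq_norm, norm_pairPt_sub]) φ

/-- The function `y ↦ ρ_ε(x - y)`, where `ρ_ε = ε^{-d} ρ(· / ε)` and `d` is the dimension. -/
def rescaledAt {ι : Type*} [Fintype ι] (ρ : 𝓢(Eu ι, ℂ)) (ε : ℝ) (hε : 0 < ε) (x : Eu ι) :
    𝓢(Eu ι, ℂ) :=
  ((ε : ℂ) ^ Fintype.card ι)⁻¹ •
    SchwartzMap.compSubConstCLM ℂ x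
      (SchwartzMap.compCLMOfContinuousLinearEquiv ℂ (LinearIsometryEquiv.neg ℝ).toContinuousLinearEquiv
        (divDilate ε hε ρ))

lemma shiftBy_apply {ι : Type*} [Fintype ι] (x y : Eu ι) (φ : 𝓢(Eu ι, ℂ)) :
    shiftBy x φ y = φ (x + y) := by
  simp [shiftBy, SchwartzMap.compSubConstCLM_apply, add_comm]

lemma divDilate_apply {ι : Type*} [Fintype ι] (δ : ℝ) (hδ : 0 < δ) (φ : 𝓢(Eu ι, ℂ)) (y : Eu ι) :
    divDilate δ hδ φ y = φ (δ⁻¹ • y) := rfl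

lemma slice_apply (x₂ : Eu (Fin n₂)) (φ : 𝓢(EuSum n₁ n₂, ℂ)) (x₁ : Eu (Fin n₁)) :
    slice x₂ φ x₁ = φ (pairPt x₁ x₂) := rfl

lemma rescaledAt_apply {ι : Type*} [Fintype ι] (ρ : 𝓢(Eu ι, ℂ)) (ε : ℝ) (hε : 0 < ε)
    (x y : Eu ι) :
    rescaledAt ρ ε hε x y = ((ε : ℂ) ^ Fintype.card ι)⁻¹ * ρ (ε⁻¹ • (x - y)) := by
  simp [rescaledAt, SchwartzMap.compSubConstCLM_apply, divDilate_apply]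

/-! ### Singular integrals of fundamental type -/

/-- `K ∈ 𝓢'(ℝ^d)` is a singular kernel of fundamental type: its Fourier transform is a bounded
function, and away from the origin `K` is a `C¹` function `k` with `|k| ≤ C₀ |x|^{-d}`,
`|∇k| ≤ C₁ |x|^{-d-1}` and bounded integrals over all annuli. -/
structure IsFundamentalKernel {d : ℕ} (K : 𝓢'(Eu (Fin d), ℂ)) : Prop where
  fourier_bounded : ∃ m : Lp ℂ ∞ (volume : Measure (Eu (Fin d))),
    𝓕 K = (m : 𝓢'(Eu (Fin d), ℂ))
  away_from_origin : ∃ k : Eu (Fin d) → ℂ,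
    (∀ φ : 𝓢(Eu (Fin d), ℂ), HasCompactSupport φ → 0 ∉ tsupport φ → K φ = ∫ x, k x * φ x) ∧
    ContDiffOn ℝ 1 k {0}ᶜ ∧
    (∃ C₀ : ℝ, 0 ≤ C₀ ∧ ∀ x ≠ 0, ‖k x‖ ≤ C₀ / ‖x‖ ^ d) ∧
    (∃ C₁ : ℝ, 0 ≤ C₁ ∧ ∀ x ≠ 0, ‖fderiv ℝ k x‖ ≤ C₁ / ‖x‖ ^ (d + 1)) ∧
    (∃ A₁ : ℝ, 0 ≤ A₁ ∧ ∀ R₁ R₂ : ℝ, 0 < R₁ → R₁ < R₂ →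
      ‖∫ x in {x | R₁ < ‖x‖ ∧ ‖x‖ < R₂}, k x‖ ≤ A₁)

/-- The integral of a function against a finite signed measure. -/
def signedIntegral {d : ℕ} (g : SignedMeasure (Eu (Fin d))) (φ : Eu (Fin d) → ℂ) : ℂ :=
  (∫ x, φ x ∂g.toJordanDecomposition.posPart) - ∫ x, φ x ∂g.toJordanDecomposition.negPart

/-- The singular integral `R g` with kernel `K` of a finite signed measure `g`, as a distribution:
`⟨R g, φ⟩ = ⟨g, R̃ φ⟩`, where `R̃ φ = K̃ * φ`, `K̃(x) = K(-x)`, that is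
`(R̃ φ)(x) = ⟨K̃, φ(x - ·)⟩ = ⟨K, φ(x + ·)⟩`. -/
def singularIntegral {d : ℕ} (K : 𝓢'(Eu (Fin d), ℂ)) (g : SignedMeasure (Eu (Fin d)))
    (φ : 𝓢(Eu (Fin d), ℂ)) : ℂ :=
  signedIntegral g fun x => K (shiftBy x φ)

/-- The distribution `T(x₁) γ(x₂)` on `ℝ^N`, for a distribution `T` on `ℝ^{n₁}` and a function
`γ` on `ℝ^{n₂}`: `⟨T ⊗ γ, φ⟩ = ∫ γ(x₂) ⟨T, φ(·, x₂)⟩ dx₂`. -/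
def distTensor (T : 𝓢(Eu (Fin n₁), ℂ) → ℂ) (γ : Eu (Fin n₂) → ℝ) (φ : 𝓢(EuSum n₁ n₂, ℂ)) : ℂ :=
  ∫ x₂, (γ x₂ : ℂ) * T (slice x₂ φ)

/-- `∂_j f = u` in the sense of distributions on `ℝ^N`. -/
def HasDistribDeriv (f : EuSum n₁ n₂ → ℝ) (j : Fin n₁ ⊕ Fin n₂)
    (u : 𝓢(EuSum n₁ n₂, ℂ) → ℂ) : Prop :=
  ∀ φ : 𝓢(EuSum n₁ n₂, ℂ), HasCompactSupport φ →
    -∫ x, (f x : ℂ) * fderiv ℝ φ x (EuclideanSpace.single j 1) = u φ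

/-! ### Tensor products of test functions and the smooth maximal function -/

/-- The test function `a(x₁) b(x₂)` on `ℝ^N`. -/
def testTensor (a : 𝓓((⊤ : Opens (Eu (Fin n₁))), ℝ)) (b : 𝓓((⊤ : Opens (Eu (Fin n₂))), ℝ)) :
    𝓢(EuSum n₁ n₂, ℂ) :=
  HasCompactSupport.toSchwartzMap
    (f := fun x : EuSum n₁ n₂ => ((a (fstPart x) * b (sndPart x) : ℝ) : ℂ))
    (by
      refine HasCompactSupport.of_support_subset_isCompact
        ((a.hasCompactSupport'.isCompact.prod b.hasCompactSupport'.isCompact).image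
          continuous_pairPt) fun x hx => ?_
      have h : a (fstPart x) ≠ 0 ∧ b (sndPart x) ≠ 0 := by
        simpa [Function.mem_support] using hx
      exact ⟨(fstPart x, sndPart x),
        ⟨subset_tsupport _ h.1, subset_tsupport _ h.2⟩, pairPt_fst_snd x⟩)
    (Complex.ofRealCLM.contDiff.comp
      ((a.contDiff'.comp contDiff_fstPart).mul (b.contDiff'.comp contDiff_sndPart)))

lemma testTensor_apply (a : 𝓓((⊤ : Opens (Eu (Fin n₁))), ℝ))
    (b : 𝓓((⊤ : Opens (Eu (Fin n₂))), ℝ)) (x : EuSum n₁ n₂) :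
    testTensor a b x = ((a (fstPart x) * b (sndPart x) : ℝ) : ℂ) := rfl

/-- The tensor-product smooth maximal function
`sup_{ε > 0} sup_ν |⟨u, (a^ν ⊗ b^ν)_ε(x - ·)⟩|` of a distribution `u` on `ℝ^N`. -/
def tensorMaximal {I : Type*} (a : I → 𝓓((⊤ : Opens (Eu (Fin n₁))), ℝ))
    (b : I → 𝓓((⊤ : Opens (Eu (Fin n₂))), ℝ)) (u : 𝓢(EuSum n₁ n₂, ℂ) → ℂ)
    (x : EuSum n₁ n₂) : ℝ≥0∞ :=
  ⨆ (ε : ℝ) (hε : 0 < ε) (ν : I), ‖u (rescaledAt (testTensor (a ν) (b ν)) ε hε x)‖ₑ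

/-! ### The families `Υ^{ξ,j}` and `Ῡ^{ξ,j}` -/

/-- `w ↦ h(c - w) p(w)` as a test function, for a test function `h` and a smooth `p`. -/
def reflectMul {d : ℕ} (h : 𝓓((⊤ : Opens (Eu (Fin d))), ℝ)) (c : Eu (Fin d))
    (p : Eu (Fin d) → ℝ) (hp : ContDiff ℝ ∞ p) : 𝓓((⊤ : Opens (Eu (Fin d))), ℝ) where
  toFun w := h (c - w) * p w
  contDiff' := (h.contDiff'.comp (contDiff_const.sub contDiff_id)).mul hp
  hasCompactSupport' :=
    (h.hasCompactSupport'.comp_homeomorph (Homeomorph.subLeft c)).mul_right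
  tsupport_subset' := fun _ _ => trivial

/-- `{w₁}^j = (w₁, 1, …, 1) · e_j`. -/
def coordFst (j : Fin n₁ ⊕ Fin n₂) (w₁ : Eu (Fin n₁)) : ℝ :=
  Sum.elim (fun i => w₁ i) (fun _ => 1) j

/-- `{w₂}^j = (1, …, 1, w₂) · e_j`. -/
def coordSnd (j : Fin n₁ ⊕ Fin n₂) (w₂ : Eu (Fin n₂)) : ℝ :=
  Sum.elim (fun _ => 1) (fun i => w₂ i) j

lemma contDiff_coordFst (j : Fin n₁ ⊕ Fin n₂) : ContDiff ℝ ∞ (coordFst j) := by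
  rcases j with i | i <;> (unfold coordFst; simp only [Sum.elim_inl, Sum.elim_inr]; fun_prop)

lemma contDiff_coordSnd (j : Fin n₁ ⊕ Fin n₂) : ContDiff ℝ ∞ (coordSnd j) := by
  rcases j with i | i <;> (unfold coordSnd; simp only [Sum.elim_inl, Sum.elim_inr]; fun_prop)

/-- `Υ^{ξ,j}(w₁) = h₁(ξ₁/2 - w₁) {w₁}^j`. -/
def upsilon (h₁ : 𝓓((⊤ : Opens (Eu (Fin n₁))), ℝ)) (j : Fin n₁ ⊕ Fin n₂) (ξ : EuSum n₁ n₂) :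
    𝓓((⊤ : Opens (Eu (Fin n₁))), ℝ) :=
  reflectMul h₁ ((1 / 2 : ℝ) • fstPart ξ) (coordFst j) (contDiff_coordFst j)

/-- `Ῡ^{ξ,j}(w₂) = h₂(ξ₂/2 - w₂) {w₂}^j`. -/
def upsilonBar (h₂ : 𝓓((⊤ : Opens (Eu (Fin n₂))), ℝ)) (j : Fin n₁ ⊕ Fin n₂) (ξ : EuSum n₁ n₂) :
    𝓓((⊤ : Opens (Eu (Fin n₂))), ℝ) :=
  reflectMul h₂ ((1 / 2 : ℝ) • sndPart ξ) (coordSnd j) (contDiff_coordSnd j)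

/-! ### The dilation `A` and the rescaled data -/

/-- `A = Diag(δ₁, …, δ₁, δ₂, …, δ₂)`. -/
def dilMatrix (n₁ n₂ : ℕ) (δ₁ δ₂ : ℝ) : Matrix (Fin n₁ ⊕ Fin n₂) (Fin n₁ ⊕ Fin n₂) ℝ :=
  Matrix.diagonal (Sum.elim (fun _ => δ₁) (fun _ => δ₂))

/-- The kernel `K^δ(x) = δ^d K(δ x)`, that is `⟨K^δ, φ⟩ = ⟨K, φ(· / δ)⟩`. -/
def dilKernel {d : ℕ} (δ : ℝ) (hδ : 0 < δ) (K : 𝓢'(Eu (Fin d), ℂ)) : 𝓢'(Eu (Fin d), ℂ) :=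
  PointwiseConvergenceCLM.precomp ℂ (divDilate δ hδ) K

/-- The measure `ǧ = g(δ ·)`, that is `⟨ǧ, φ⟩ = δ^{-d} ⟨g, φ(· / δ)⟩`. -/
def dilMeasure {d : ℕ} (δ : ℝ) (g : SignedMeasure (Eu (Fin d))) : SignedMeasure (Eu (Fin d)) :=
  (δ ^ d)⁻¹ • g.map fun x => δ⁻¹ • x

/-- The function
`U(x) = ∑_j ∑_k [M_{Υ^{ξ,j} ⊗ Ῡ^{ξ,j}, ξ ∈ 𝕊^{N-1}} (A_jj (R_jk^{δ₁} ǧ_jk) γ̌_jk)](A⁻¹ x)`,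
where `R_jk^{δ₁}` has kernel `K_jk^{δ₁}`, `ǧ_jk = g_jk(δ₁ ·)` and `γ̌_jk = γ_jk(δ₂ ·)`. -/
def anisotropicU {m : ℕ} (h₁ : 𝓓((⊤ : Opens (Eu (Fin n₁))), ℝ))
    (h₂ : 𝓓((⊤ : Opens (Eu (Fin n₂))), ℝ)) (δ₁ δ₂ : ℝ) (hδ₁ : 0 < δ₁)
    (K : Fin n₁ ⊕ Fin n₂ → Fin m → 𝓢'(Eu (Fin n₁), ℂ))
    (g : Fin n₁ ⊕ Fin n₂ → Fin m → SignedMeasure (Eu (Fin n₁)))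
    (γ : Fin n₁ ⊕ Fin n₂ → Fin m → Eu (Fin n₂) → ℝ) (x : EuSum n₁ n₂) : ℝ≥0∞ :=
  ∑ j, ∑ k,
    tensorMaximal
      (fun ξ : Metric.sphere (0 : EuSum n₁ n₂) 1 => upsilon h₁ j ξ)
      (fun ξ : Metric.sphere (0 : EuSum n₁ n₂) 1 => upsilonBar h₂ j ξ)
      (fun φ => (dilMatrix n₁ n₂ δ₁ δ₂ j j : ℂ) *
        distTensor (singularIntegral (dilKernel δ₁ hδ₁ (K j k)) (dilMeasure δ₁ (g j k)))
          (fun x₂ => γ j k (δ₂ • x₂)) φ)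
      (Matrix.toEuclideanLin (dilMatrix n₁ n₂ δ₁ δ₂)⁻¹ x)

end AnisotropicDQ

end

namespace AnisotropicDQ

open Metric Filter Set Topology NNReal

/-! ### Finiteness almost everywhere of centred maximal functions -/

section MaximalBound

variable {ι : Type*} [Fintype ι]

/-! For a unit vector `ξ`, average `f` near `x` at scale `s`: integrate `f` against the normalised
profile `h₁(ξ₁/2 - w₁) h₂(ξ₂/2 - w₂)` evaluated at `w = s⁻¹ A⁻¹(x - z)` (`dilAverage`). Three facts
about these averages give the inequality.

They tend to `f x` as `s → 0` at Lebesgue points, since the profile has integral one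
(`ae_tendsto_dilAverage`). With `r = |A⁻¹(x - y)|` and `r ξ = A⁻¹(x - y)`, the average at `x` in
direction `ξ` and the average at `y` in direction `-ξ` coincide at scale `r` (`dilAverage_symm`):
the shift `ξ/2` centres both at the midpoint. Finally, the `s`-derivative of the mollifier `s^{-N}
Φ(w)` is `-s^{-(N+1)} div(w Φ(w))`. Integrating by parts turns the derivative of the average into a
pairing of the `A_jj ∂_j f` with the functions `w_j Φ(w)`. These are exactly the tensors `Υ^{ξ,j} ⊗
Ῡ^{ξ,j}`, so the derivative is at most `U x` (`exists_hasDerivAt_dilAverage`). Hence the common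
average differs from `f x` by at most `r U(x)` and from `f y` by at most `r U(y)`.

It remains to show `U < ∞` almost everywhere (`ae_anisotropicU_lt_top`). Each pairing factors into
one in `x₁` and one in `x₂`, and the dilations only change the scales to `δ₁ s` and `δ₂ s`. The `x₂`
factor is controlled by the maximal function of an `L^q` function. The `x₁` factor is a smooth
maximal function of the singular integral of a measure, treated by a Calderón–Zygmund argument
(`exists_good_density`). Let `F` be the closed set where the maximal function of the measure is at
most `l`. The measure has bounded density on `F`; off `F` each point mass is spread over a ball of
radius a quarter of its distance to `F`, which again gives a bounded density. The resulting function
is in `L¹ ∩ L²`, where the bounded multiplier `K̂` and the maximal theorem apply. At points of `F`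
the spreading error is controlled by the regularity of the mollified kernel, uniform in the scale
(`exists_kernel_regularity`), and by a Marcinkiewicz-type integral that is finite almost everywhere.
Letting `l` run through the naturals exhausts almost every point. -/

lemma volume_closedBall_eq (x : Eu ι) {r : ℝ} (hr : 0 ≤ r) :
    volume (closedBall x r) =
      ENNReal.ofReal ((volume.real (closedBall (0 : Eu ι) 1)) * r ^ Fintype.card ι) := by
  rw [Measure.addHaar_closedBall' _ _ hr, ENNReal.ofReal_mul measureReal_nonneg,
    measureReal_def, ENNReal.ofReal_toReal measure_closedBall_lt_top.ne, mul_comm,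
    finrank_euclideanSpace]

lemma volume_unit_closedBall_pos : 0 < volume.real (closedBall (0 : Eu ι) 1) :=
  ENNReal.toReal_pos (measure_closedBall_pos _ _ one_pos).ne' measure_closedBall_lt_top.ne

/-- The maximal function of a finite measure is finite almost everywhere. -/
lemma ae_exists_closedBall_le_of_finite (ρ : Measure (Eu ι)) [IsFiniteMeasure ρ] :
    ∀ᵐ z ∂(volume : Measure (Eu ι)), ∃ C : ℝ, 0 ≤ C ∧ ∀ r : ℝ, 0 < r →
      ρ (closedBall z r) ≤ ENNReal.ofReal (C * r ^ Fintype.card ι) := by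
  -- Only finiteness is needed, so differentiation of measures replaces the weak-type inequality:
  -- small balls are controlled by the finite density at `z`, large ones by the total mass.
  filter_upwards [Besicovitch.ae_tendsto_rnDeriv ρ volume, ρ.rnDeriv_lt_top volume] with z hz hfin
  obtain ⟨L, hL⟩ : ∃ L : ℝ≥0, ρ.rnDeriv volume z < L := ENNReal.lt_iff_exists_nnreal_btwn.1 hfin
    |>.imp fun _ h => h.1
  obtain ⟨r₀, hr₀, hsmall⟩ : ∃ r₀ > 0, ∀ r, 0 < r → r < r₀ →
      ρ (closedBall z r) / volume (closedBall z r) < L := by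
    obtain ⟨s, hs, h⟩ := Metric.eventually_nhds_iff.1
      (eventually_nhdsWithin_iff.1 (hz.eventually_lt_const hL))
    exact ⟨s, hs, fun r h0 h1 => h (by simpa [abs_of_pos h0] using h1) h0⟩
  set c := volume.real (closedBall (0 : Eu ι) 1)
  set C₂ := ρ.real univ / (r₀ / 2) ^ Fintype.card ι
  have hC₂ : 0 ≤ C₂ := by positivity
  refine ⟨L * c + C₂, by positivity, fun r hr => ?_⟩
  rcases lt_or_ge r r₀ with h | h
  · have h1 := (hsmall r hr h).le
    have hpos := measure_closedBall_pos (volume : Measure (Eu ι)) z hr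
    rw [ENNReal.div_le_iff hpos.ne' measure_closedBall_lt_top.ne, volume_closedBall_eq z hr.le,
      ← ENNReal.ofReal_coe_nnreal, ← ENNReal.ofReal_mul L.coe_nonneg] at h1
    refine h1.trans (ENNReal.ofReal_le_ofReal ?_)
    rw [← mul_assoc]
    gcongr
    linarith
  · calc ρ (closedBall z r) ≤ ρ univ := measure_mono (subset_univ _)
      _ = ENNReal.ofReal (ρ.real univ) := by simp [measureReal_def]
      _ ≤ _ := by
        refine ENNReal.ofReal_le_ofReal ?_
        have h2 : ρ.real univ = C₂ * (r₀ / 2) ^ Fintype.card ι := by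
          rw [div_mul_cancel₀]; positivity
        rw [h2]
        gcongr
        · have : 0 ≤ (L : ℝ) * c := by positivity
          linarith
        · linarith

lemma ae_exists_closedBall_le (μ ρ : Measure (Eu ι)) [IsFiniteMeasure ρ] (a : ℝ≥0)
    (h : μ ≤ a • volume + ρ) :
    ∀ᵐ z ∂(volume : Measure (Eu ι)), ∃ C : ℝ, 0 ≤ C ∧ ∀ r : ℝ, 0 < r →
      μ (closedBall z r) ≤ ENNReal.ofReal (C * r ^ Fintype.card ι) := by
  filter_upwards [ae_exists_closedBall_le_of_finite ρ] with z ⟨C, hC, hz⟩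
  refine ⟨a * volume.real (closedBall (0 : Eu ι) 1) + C, by positivity, fun r hr => ?_⟩
  calc μ (closedBall z r) ≤ a * volume (closedBall z r) + ρ (closedBall z r) := by
        simpa using h (closedBall z r)
    _ ≤ ENNReal.ofReal (a * (volume.real (closedBall (0 : Eu ι) 1) * r ^ Fintype.card ι)) +
          ENNReal.ofReal (C * r ^ Fintype.card ι) := by
        gcongr
        · rw [volume_closedBall_eq z hr.le, ENNReal.ofReal_mul a.coe_nonneg,
            ENNReal.ofReal_coe_nnreal]
        · exact hz r hr
    _ = _ := by
        rw [← ENNReal.ofReal_add (by positivity) (by positivity)]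
        congr 1; ring

/-- The centred maximal function of an `L^q` function is finite almost everywhere. -/
lemma ae_exists_setIntegral_norm_le {F : Type*} [NormedAddCommGroup F] {h : Eu ι → F} {q : ℝ≥0∞}
    (hq : 1 ≤ q) (hh : MemLp h q volume) :
    ∀ᵐ z ∂(volume : Measure (Eu ι)), ∃ C : ℝ, 0 ≤ C ∧ ∀ r : ℝ, 0 < r →
      IntegrableOn h (closedBall z r) ∧
      ∫ y in closedBall z r, ‖h y‖ ≤ C * r ^ Fintype.card ι := by
  -- For `q = ∞` the measure `|h| dy` is dominated by a multiple of Lebesgue measure. For finite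
  -- `q`, `|h| ≤ 1 + |h|^q` gives Lebesgue measure plus a finite measure.
  obtain ⟨a, ρ, hρ, hle⟩ : ∃ (a : ℝ≥0) (ρ : Measure (Eu ι)), IsFiniteMeasure ρ ∧
      volume.withDensity (fun y => ‖h y‖ₑ) ≤ a • volume + ρ := by
    rcases eq_or_ne q ∞ with rfl | hq'
    · have hfin := hh.eLpNorm_lt_top
      refine ⟨(eLpNorm h ∞ volume).toNNReal, 0, inferInstance, ?_⟩
      rw [add_zero]
      refine Measure.le_iff.2 fun s hs => ?_
      rw [withDensity_apply _ hs]
      calc ∫⁻ y in s, ‖h y‖ₑ ≤ ∫⁻ y in s, eLpNorm h ∞ volume := by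
            refine lintegral_mono_ae (ae_restrict_of_ae ?_)
            rw [eLpNorm_exponent_top]; exact ae_le_eLpNormEssSup
        _ = _ := by
          rw [setLIntegral_const, Measure.smul_apply, ENNReal.smul_def, smul_eq_mul,
            ENNReal.coe_toNNReal hfin.ne]
    · have hfin := lintegral_rpow_enorm_lt_top_of_eLpNorm_lt_top
        (zero_lt_one.trans_le hq).ne' hq' hh.eLpNorm_lt_top
      refine ⟨1, volume.withDensity fun y => ‖h y‖ₑ ^ q.toReal, isFiniteMeasure_withDensity hfin.ne,
        ?_⟩
      refine Measure.le_iff.2 fun s hs => ?_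
      have h1q : 1 ≤ q.toReal := by
        simpa using ENNReal.toReal_mono hq' hq
      rw [Measure.add_apply, withDensity_apply _ hs, withDensity_apply _ hs]
      calc ∫⁻ y in s, ‖h y‖ₑ ≤ ∫⁻ y in s, (1 + ‖h y‖ₑ ^ q.toReal) := by
            refine lintegral_mono fun y => ?_
            rcases le_total ‖h y‖ₑ 1 with h1 | h1
            · exact h1.trans le_self_add
            · calc ‖h y‖ₑ = ‖h y‖ₑ ^ (1 : ℝ) := by simp
                _ ≤ ‖h y‖ₑ ^ q.toReal := ENNReal.rpow_le_rpow_of_exponent_le h1 h1q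
                _ ≤ _ := le_add_self
        _ = _ := by
            rw [lintegral_add_left measurable_const]; simp
  filter_upwards [ae_exists_closedBall_le _ ρ a hle] with z ⟨C, hC, hz⟩
  refine ⟨C, hC, fun r hr => ?_⟩
  have h1 := hz r hr
  rw [withDensity_apply _ measurableSet_closedBall] at h1
  refine ⟨⟨hh.aestronglyMeasurable.restrict, h1.trans_lt ENNReal.ofReal_lt_top⟩, ?_⟩
  rw [integral_norm_eq_lintegral_enorm hh.aestronglyMeasurable.restrict]
  exact ENNReal.toReal_le_of_le_ofReal (by positivity) h1

end MaximalBound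

/-! ### Fourier-side bounds and regularity of mollified kernels -/

section KernelEstimates

variable {d : ℕ}

/-- The dilate `ε^{-d} φ(· / ε)`. -/
noncomputable def normDilate (ε : ℝ) (hε : 0 < ε) (φ : 𝓢(Eu (Fin d), ℂ)) : 𝓢(Eu (Fin d), ℂ) :=
  ((ε : ℂ) ^ d)⁻¹ • divDilate ε hε φ

lemma normDilate_apply (ε : ℝ) (hε : 0 < ε) (φ : 𝓢(Eu (Fin d), ℂ)) (y : Eu (Fin d)) :
    normDilate ε hε φ y = ((ε : ℂ) ^ d)⁻¹ * φ (ε⁻¹ • y) := rfl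

lemma fourierInv_normDilate (ε : ℝ) (hε : 0 < ε) (φ : 𝓢(Eu (Fin d), ℂ)) (ξ : Eu (Fin d)) :
    𝓕⁻ (normDilate ε hε φ) ξ = 𝓕⁻ φ (ε • ξ) := by
  rw [SchwartzMap.fourierInv_coe, SchwartzMap.fourierInv_coe, Real.fourierInv_eq,
    Real.fourierInv_eq]
  have h := Measure.integral_comp_inv_smul (volume : Measure (Eu (Fin d)))
    (fun v => 𝐞 (inner ℝ v (ε • ξ)) • φ v) ε
  have h2 : ∀ v : Eu (Fin d), 𝐞 (inner ℝ v ξ) • normDilate ε hε φ v =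
      ((ε : ℂ) ^ d)⁻¹ * (𝐞 (inner ℝ (ε⁻¹ • v) (ε • ξ)) • φ (ε⁻¹ • v)) := by
    intro v
    rw [normDilate_apply, real_inner_smul_left, real_inner_smul_right, inv_mul_cancel_left₀ hε.ne',
      Circle.smul_def, Circle.smul_def, smul_eq_mul, smul_eq_mul]
    ring
  simp_rw [h2]
  rw [integral_const_mul, h, finrank_euclideanSpace, Fintype.card_fin, abs_of_pos (by positivity),
    Complex.real_smul, ← mul_assoc]
  have : ((ε : ℂ) ^ d)⁻¹ * ((ε ^ d : ℝ) : ℂ) = 1 := by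
    push_cast
    exact inv_mul_cancel₀ (pow_ne_zero _ (by exact_mod_cast hε.ne'))
  rw [this, one_mul]

lemma fourierInv_shiftBy (y : Eu (Fin d)) (φ : 𝓢(Eu (Fin d), ℂ)) (ξ : Eu (Fin d)) :
    𝓕⁻ (shiftBy y φ) ξ = 𝐞 (-inner ℝ y ξ) • 𝓕⁻ φ ξ := by
  rw [SchwartzMap.fourierInv_coe, SchwartzMap.fourierInv_coe, Real.fourierInv_eq,
    Real.fourierInv_eq]
  have h := integral_add_left_eq_self (μ := (volume : Measure (Eu (Fin d))))
    (fun v => 𝐞 (-inner ℝ y ξ) • (𝐞 (inner ℝ v ξ) • φ v)) y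
  have h2 : ∀ v : Eu (Fin d), 𝐞 (inner ℝ v ξ) • shiftBy y φ v =
      𝐞 (-inner ℝ y ξ) • (𝐞 (inner ℝ (y + v) ξ) • φ (y + v)) := by
    intro v
    rw [shiftBy_apply, inner_add_left, smul_smul, ← AddChar.map_add_eq_mul, neg_add_cancel_left]
  simp_rw [h2]
  rw [h]
  simp_rw [Circle.smul_def]
  rw [integral_smul]

variable {K : 𝓢'(Eu (Fin d), ℂ)} {m : Lp ℂ ∞ (volume : Measure (Eu (Fin d)))}

lemma kernel_apply (hK : 𝓕 K = (m : 𝓢'(Eu (Fin d), ℂ))) (φ : 𝓢(Eu (Fin d), ℂ)) :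
    K φ = ∫ ξ, 𝓕⁻ φ ξ * m ξ := by
  have h1 : K φ = 𝓕 K (𝓕⁻ φ) := by
    rw [TemperedDistribution.fourier_apply, FourierTransform.fourier_fourierInv_eq]
  rw [h1, hK, Lp.toTemperedDistribution_apply]
  simp

lemma kernel_shiftBy (hK : 𝓕 K = (m : 𝓢'(Eu (Fin d), ℂ))) (φ : 𝓢(Eu (Fin d), ℂ))
    (y : Eu (Fin d)) :
    K (shiftBy y φ) = ∫ ξ, (𝐞 (-inner ℝ y ξ) : ℂ) * (𝓕⁻ φ ξ * m ξ) := by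
  rw [kernel_apply hK]
  simp_rw [fourierInv_shiftBy, Circle.smul_def, smul_eq_mul, mul_assoc]

lemma ae_norm_le_of_Lp_top (m : Lp ℂ ∞ (volume : Measure (Eu (Fin d)))) :
    ∀ᵐ ξ ∂(volume : Measure (Eu (Fin d))), ‖m ξ‖ ≤ ‖m‖ := by
  have h := ae_le_eLpNormEssSup (f := m) (μ := (volume : Measure (Eu (Fin d))))
  have hfin := Lp.eLpNorm_lt_top m
  filter_upwards [h] with ξ hξ
  rw [Lp.norm_def, eLpNorm_exponent_top]
  rw [eLpNorm_exponent_top] at hfin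
  rw [← toReal_enorm]
  exact ENNReal.toReal_mono hfin.ne hξ

lemma integrable_fourierInv_mul (φ : 𝓢(Eu (Fin d), ℂ))
    (m : Lp ℂ ∞ (volume : Measure (Eu (Fin d)))) :
    Integrable fun ξ => 𝓕⁻ φ ξ * m ξ :=
  ((𝓕⁻ φ).integrable (μ := volume)).mul_bdd (c := ‖m‖) (Lp.aestronglyMeasurable m)
    (ae_norm_le_of_Lp_top m)

lemma norm_fourierChar_sub_le (a b : ℝ) : ‖(𝐞 a : ℂ) - 𝐞 b‖ ≤ 2 * Real.pi * |a - b| := by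
  have h : (𝐞 a : ℂ) - 𝐞 b =
      𝐞 b * (Complex.exp (Complex.I * (2 * Real.pi * (a - b) : ℝ)) - 1) := by
    rw [Real.fourierChar_apply, Real.fourierChar_apply, mul_sub, mul_one, ← Complex.exp_add]
    congr 2
    push_cast
    ring
  rw [h, norm_mul, Circle.norm_coe, one_mul]
  refine (Real.norm_exp_I_mul_ofReal_sub_one_le).trans ?_
  rw [Real.norm_eq_abs, abs_mul, abs_of_pos Real.two_pi_pos]

lemma norm_kernel_shiftBy_le (hK : 𝓕 K = (m : 𝓢'(Eu (Fin d), ℂ))) (φ : 𝓢(Eu (Fin d), ℂ))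
    (y : Eu (Fin d)) : ‖K (shiftBy y φ)‖ ≤ ‖m‖ * ∫ ξ, ‖𝓕⁻ φ ξ‖ := by
  rw [kernel_shiftBy hK, ← integral_const_mul]
  refine norm_integral_le_of_norm_le (((𝓕⁻ φ).integrable (μ := volume)).norm.const_mul _) ?_
  filter_upwards [ae_norm_le_of_Lp_top m] with ξ hξ
  rw [norm_mul, Circle.norm_coe, one_mul, norm_mul, mul_comm]
  gcongr

/-- Translating `φ` multiplies its inverse Fourier transform by a character, which is Lipschitz in
the translation with constant `2π|ξ|`; the multiplier `m` is bounded. -/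
lemma norm_kernel_shiftBy_sub_le (hK : 𝓕 K = (m : 𝓢'(Eu (Fin d), ℂ))) (φ : 𝓢(Eu (Fin d), ℂ))
    (y y' : Eu (Fin d)) :
    ‖K (shiftBy y φ) - K (shiftBy y' φ)‖ ≤
      2 * Real.pi * ‖m‖ * (∫ ξ, ‖ξ‖ * ‖𝓕⁻ φ ξ‖) * ‖y - y'‖ := by
  have hi : ∀ y : Eu (Fin d), Integrable fun ξ => (𝐞 (-inner ℝ y ξ) : ℂ) * (𝓕⁻ φ ξ * m ξ) := by
    intro y
    refine (integrable_fourierInv_mul φ m).bdd_mul (c := 1) ?_ ?_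
    · refine Continuous.aestronglyMeasurable ?_
      have := Real.continuous_fourierChar
      fun_prop
    · exact Eventually.of_forall fun ξ => by rw [Circle.norm_coe]
  rw [kernel_shiftBy hK, kernel_shiftBy hK, ← integral_sub (hi y) (hi y')]
  have h1 : Integrable fun ξ => ‖ξ‖ * ‖𝓕⁻ φ ξ‖ := by
    have h := (𝓕⁻ φ).integrable_pow_mul (volume : Measure (Eu (Fin d))) 1
    simp only [pow_one] at h
    exact h
  calc _ ≤ ∫ ξ, (2 * Real.pi * ‖m‖ * ‖y - y'‖) * (‖ξ‖ * ‖𝓕⁻ φ ξ‖) := by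
        refine norm_integral_le_of_norm_le (h1.const_mul _) ?_
        filter_upwards [ae_norm_le_of_Lp_top m] with ξ hξ
        rw [← sub_mul, norm_mul, norm_mul]
        have h2 : ‖(𝐞 (-inner ℝ y ξ) : ℂ) - 𝐞 (-inner ℝ y' ξ)‖ ≤
            2 * Real.pi * (‖y - y'‖ * ‖ξ‖) := by
          refine (norm_fourierChar_sub_le _ _).trans ?_
          have h3 : |-inner ℝ y ξ - -inner ℝ y' ξ| = |inner ℝ (y - y') ξ| := by
            rw [← neg_sub_neg, neg_neg, neg_neg, inner_sub_left, abs_sub_comm]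
          rw [h3]
          gcongr
          exact abs_real_inner_le_norm _ _
        calc _ ≤ 2 * Real.pi * (‖y - y'‖ * ‖ξ‖) * (‖𝓕⁻ φ ξ‖ * ‖m‖) := by gcongr
          _ = _ := by ring
    _ = _ := by rw [integral_const_mul]; ring

lemma continuous_kernel_shiftBy (hK : 𝓕 K = (m : 𝓢'(Eu (Fin d), ℂ))) (φ : 𝓢(Eu (Fin d), ℂ)) :
    Continuous fun y => K (shiftBy y φ) := by
  have hC : 0 ≤ 2 * Real.pi * ‖m‖ * (∫ ξ, ‖ξ‖ * ‖𝓕⁻ φ ξ‖) := by positivity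
  exact (LipschitzWith.of_dist_le_mul (K := ⟨_, hC⟩) fun y y' => by
    rw [dist_eq_norm, dist_eq_norm]
    exact norm_kernel_shiftBy_sub_le hK φ y y').continuous

/-- The inverse transform of the dilate is `𝓕⁻ φ (ε ξ)`. The change of variables costs `ε^{-d}`, and
the weight `|ξ|` one more factor `ε⁻¹`. -/
lemma norm_kernel_normDilate_sub_le (hK : 𝓕 K = (m : 𝓢'(Eu (Fin d), ℂ)))
    (φ : 𝓢(Eu (Fin d), ℂ)) {ε : ℝ} (hε : 0 < ε) (y y' : Eu (Fin d)) :
    ‖K (shiftBy y (normDilate ε hε φ)) - K (shiftBy y' (normDilate ε hε φ))‖ ≤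
      2 * Real.pi * ‖m‖ * (∫ ξ, ‖ξ‖ * ‖𝓕⁻ φ ξ‖) * ‖y - y'‖ / ε ^ (d + 1) := by
  refine (norm_kernel_shiftBy_sub_le hK _ y y').trans_eq ?_
  simp_rw [fourierInv_normDilate]
  have h1 : ∀ ξ : Eu (Fin d), ‖ξ‖ * ‖𝓕⁻ φ (ε • ξ)‖ = ε⁻¹ * (‖ε • ξ‖ * ‖𝓕⁻ φ (ε • ξ)‖) := by
    intro ξ
    rw [norm_smul, Real.norm_of_nonneg hε.le]
    field_simp
  simp_rw [h1]
  rw [integral_const_mul, Measure.integral_comp_smul volume (fun ξ => ‖ξ‖ * ‖𝓕⁻ φ ξ‖) ε,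
    finrank_euclideanSpace, Fintype.card_fin, abs_of_pos (by positivity), smul_eq_mul]
  field_simp
  ring

lemma integral_norm_normDilate {ε : ℝ} (hε : 0 < ε) (φ : 𝓢(Eu (Fin d), ℂ)) :
    ∫ u, ‖normDilate ε hε φ u‖ = ∫ u, ‖φ u‖ := by
  simp_rw [normDilate_apply, norm_mul]
  rw [integral_const_mul, Measure.integral_comp_inv_smul volume (fun u => ‖φ u‖) ε,
    finrank_euclideanSpace, Fintype.card_fin, abs_of_pos (by positivity), smul_eq_mul, norm_inv,
    norm_pow, Complex.norm_real, Real.norm_of_nonneg hε.le]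
  field_simp

lemma normDilate_eq_zero {ε : ℝ} (hε : 0 < ε) {φ : 𝓢(Eu (Fin d), ℂ)} {R : ℝ}
    (hφ : ∀ x, R < ‖x‖ → φ x = 0) {x : Eu (Fin d)} (hx : R * ε < ‖x‖) :
    normDilate ε hε φ x = 0 := by
  rw [normDilate_apply, hφ, mul_zero]
  rw [norm_smul, norm_inv, Real.norm_of_nonneg hε.le]
  rwa [lt_inv_mul_iff₀ hε, mul_comm]

lemma shiftBy_kernel_eq_integral {k : Eu (Fin d) → ℂ}
    (hk : ∀ φ : 𝓢(Eu (Fin d), ℂ), HasCompactSupport φ → 0 ∉ tsupport φ → K φ = ∫ x, k x * φ x)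
    {φ : 𝓢(Eu (Fin d), ℂ)} {S : ℝ} (hφ : ∀ x, S < ‖x‖ → φ x = 0) {y : Eu (Fin d)}
    (hy : S < ‖y‖) : K (shiftBy y φ) = ∫ u, k (u - y) * φ u := by
  have hsub : Function.support (shiftBy y φ) ⊆ closedBall (-y) S := by
    intro x hx
    rw [Function.mem_support, shiftBy_apply] at hx
    rw [mem_closedBall, dist_eq_norm, sub_neg_eq_add, add_comm]
    by_contra! h
    exact hx (hφ _ h)
  have hts : tsupport (shiftBy y φ) ⊆ closedBall (-y) S :=
    closure_minimal hsub isClosed_closedBall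
  rw [hk _ (HasCompactSupport.of_support_subset_isCompact (isCompact_closedBall _ _) hsub)]
  · rw [← integral_add_left_eq_self (fun u => k (u - y) * φ u) y]
    simp_rw [shiftBy_apply, add_sub_cancel_left]
  · intro h0
    have := hts h0
    rw [mem_closedBall, dist_eq_norm, sub_neg_eq_add, zero_add] at this
    linarith

lemma integrable_kernel_mul {k : Eu (Fin d) → ℂ} (hkc : ContinuousOn k {0}ᶜ)
    {φ : 𝓢(Eu (Fin d), ℂ)} {S : ℝ} (hφ : ∀ x, S < ‖x‖ → φ x = 0) {y : Eu (Fin d)}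
    (hy : S < ‖y‖) : Integrable fun u => k (u - y) * φ u := by
  rw [← integrableOn_iff_integrable_of_support_subset (s := closedBall 0 S)]
  · refine ContinuousOn.integrableOn_compact (isCompact_closedBall _ _) ?_
    refine ContinuousOn.mul (hkc.comp (by fun_prop) fun u hu => ?_) φ.continuous.continuousOn
    rw [mem_compl_singleton_iff, sub_ne_zero]
    rintro rfl
    rw [mem_closedBall_zero_iff] at hu
    linarith
  · intro u hu
    rw [mem_closedBall_zero_iff]
    by_contra! h
    exact hu (by simp [hφ u h])

lemma exists_radius {H : 𝓢(Eu (Fin d), ℂ)} (hH : HasCompactSupport H) :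
    ∃ R : ℝ, 0 ≤ R ∧ ∀ x, R < ‖x‖ → H x = 0 := by
  obtain ⟨R, hR⟩ := hH.isCompact.isBounded.subset_closedBall 0
  refine ⟨max R 0, le_max_right _ _, fun x hx => ?_⟩
  by_contra h
  have := hR (subset_tsupport _ h)
  rw [mem_closedBall_zero_iff] at this
  exact absurd (this.trans (le_max_left R 0)) (not_le.2 hx)

/-- Both translates see only the smooth part `k`, at arguments in the ball of radius `‖y‖/2` about
`-y`. That ball is convex and stays at distance at least `‖y‖/2` from the origin, so the mean value
inequality applies with the gradient bound. -/
lemma kernel_sub_le_of_far {k : Eu (Fin d) → ℂ}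
    (hk : ∀ φ : 𝓢(Eu (Fin d), ℂ), HasCompactSupport φ → 0 ∉ tsupport φ → K φ = ∫ x, k x * φ x)
    (hkd : ContDiffOn ℝ 1 k {0}ᶜ) {C₁ : ℝ} (hC₁ : 0 ≤ C₁)
    (hk₁ : ∀ x ≠ 0, ‖fderiv ℝ k x‖ ≤ C₁ / ‖x‖ ^ (d + 1))
    {φ : 𝓢(Eu (Fin d), ℂ)} {S : ℝ} (hφ : ∀ x, S < ‖x‖ → φ x = 0) {y z z' : Eu (Fin d)}
    (hy : y ≠ 0) (hz : ‖y - z‖ + S ≤ ‖y‖ / 2) (hz' : ‖y - z'‖ + S ≤ ‖y‖ / 2) :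
    ‖K (shiftBy z φ) - K (shiftBy z' φ)‖ ≤
      C₁ / (‖y‖ / 2) ^ (d + 1) * ‖z - z'‖ * ∫ u, ‖φ u‖ := by
  have hy0 : 0 < ‖y‖ := norm_pos_iff.2 hy
  have hin : ∀ z, ‖y - z‖ + S ≤ ‖y‖ / 2 → ∀ u, ‖u‖ ≤ S → u - z ∈ closedBall (-y) (‖y‖ / 2) := by
    intro z hz u hu
    rw [mem_closedBall, dist_eq_norm]
    have : u - z - -y = u + (y - z) := by abel
    rw [this]
    have := norm_add_le u (y - z)
    linarith
  have hball : ∀ z ∈ closedBall (-y) (‖y‖ / 2), ‖y‖ / 2 ≤ ‖z‖ := by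
    intro z hz
    rw [mem_closedBall, dist_eq_norm, sub_neg_eq_add] at hz
    have := norm_sub_le (z + y) z
    rw [add_sub_cancel_left] at this
    linarith
  have hlarge : ∀ z, ‖y - z‖ + S ≤ ‖y‖ / 2 → S < ‖z‖ := by
    intro z hz
    have h2 := norm_add_le (y - z) z
    rw [sub_add_cancel] at h2
    linarith
  have hkdiff : ∀ z ∈ closedBall (-y) (‖y‖ / 2), DifferentiableAt ℝ k z := by
    intro z hz
    have hz0 : z ≠ 0 := norm_pos_iff.1 (by linarith [hball z hz])
    exact (hkd.contDiffAt (isOpen_compl_singleton.mem_nhds hz0)).differentiableAt (by simp)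
  have hkbd : ∀ z ∈ closedBall (-y) (‖y‖ / 2), ‖fderiv ℝ k z‖ ≤ C₁ / (‖y‖ / 2) ^ (d + 1) := by
    intro z hz
    have hz1 := hball z hz
    have hz0 : z ≠ 0 := norm_pos_iff.1 (by linarith)
    refine (hk₁ z hz0).trans ?_
    gcongr
  rw [shiftBy_kernel_eq_integral hk hφ (hlarge z hz),
    shiftBy_kernel_eq_integral hk hφ (hlarge z' hz'),
    ← integral_sub (integrable_kernel_mul hkd.continuousOn hφ (hlarge z hz))
      (integrable_kernel_mul hkd.continuousOn hφ (hlarge z' hz')), ← integral_const_mul]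
  refine norm_integral_le_of_norm_le ((φ.integrable (μ := volume)).norm.const_mul _)
    (Eventually.of_forall fun u => ?_)
  rw [← sub_mul, norm_mul]
  rcases le_or_gt ‖u‖ S with hu | hu
  · refine mul_le_mul_of_nonneg_right ?_ (norm_nonneg _)
    have := Convex.norm_image_sub_le_of_norm_fderiv_le hkdiff hkbd (convex_closedBall _ _)
      (hin z' hz' u hu) (hin z hz u hu)
    rwa [sub_sub_sub_cancel_left, norm_sub_rev z' z] at this
  · rw [hφ u hu, norm_zero, mul_zero, mul_zero]

/-- Uniform Hörmander-type regularity of the mollified kernels `K * H_ε`. -/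
lemma exists_kernel_regularity (hK : IsFundamentalKernel K) {H : 𝓢(Eu (Fin d), ℂ)}
    (hH : HasCompactSupport H) :
    ∃ C : ℝ, 0 ≤ C ∧ ∀ (ε : ℝ) (hε : 0 < ε) (c y y' : Eu (Fin d)), ‖c‖ ≤ 1 → y ≠ 0 →
      ‖y - y'‖ ≤ ‖y‖ / 4 →
      ‖K (shiftBy (y + ε • c) (normDilate ε hε H)) -
        K (shiftBy (y' + ε • c) (normDilate ε hε H))‖ ≤ C * (‖y - y'‖ / ‖y‖ ^ (d + 1)) := by
  obtain ⟨m, hm⟩ := hK.fourier_bounded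
  obtain ⟨k, hk, hkd, -, ⟨C₁, hC₁, hk₁⟩, -⟩ := hK.away_from_origin
  obtain ⟨R, hR0, hR⟩ := exists_radius hH
  obtain ⟨a, ha, hnear⟩ : ∃ a : ℝ, 0 ≤ a ∧ ∀ (ε : ℝ) (hε : 0 < ε) (y y' : Eu (Fin d)),
      ‖K (shiftBy y (normDilate ε hε H)) - K (shiftBy y' (normDilate ε hε H))‖ ≤
        a * ‖y - y'‖ / ε ^ (d + 1) :=
    ⟨_, by positivity, fun ε hε y y' => norm_kernel_normDilate_sub_le hm H hε y y'⟩
  obtain ⟨b, hb, hbH⟩ : ∃ b : ℝ, 0 ≤ b ∧ ∀ (ε : ℝ) (hε : 0 < ε),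
      ∫ u, ‖normDilate ε hε H u‖ = b :=
    ⟨_, integral_nonneg fun _ => norm_nonneg _, fun ε hε => integral_norm_normDilate hε H⟩
  refine ⟨a * (4 * (R + 1)) ^ (d + 1) + C₁ * 2 ^ (d + 1) * b, by positivity,
    fun ε hε c y y' hc hy hyy => ?_⟩
  have hy0 : 0 < ‖y‖ := norm_pos_iff.2 hy
  -- Near the origin the Lipschitz bound `ε^{-(d+1)}` is as good as `‖y‖^{-(d+1)}`. Otherwise the
  -- support radius `R ε` and the shift `ε c` together use at most `‖y‖/4`, and `y - y'` another
  -- quarter, which leaves the half required by `kernel_sub_le_of_far`.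
  rcases lt_or_ge ‖y‖ (4 * (R + 1) * ε) with h | h
  · calc _ ≤ a * ‖y - y'‖ / ε ^ (d + 1) := by
          have := hnear ε hε (y + ε • c) (y' + ε • c)
          rwa [add_sub_add_right_eq_sub] at this
      _ = a * (4 * (R + 1)) ^ (d + 1) * (‖y - y'‖ / (4 * (R + 1) * ε) ^ (d + 1)) := by
          rw [mul_pow _ ε]
          field_simp
      _ ≤ a * (4 * (R + 1)) ^ (d + 1) * (‖y - y'‖ / ‖y‖ ^ (d + 1)) := by
          gcongr
      _ ≤ _ := by
          rw [add_mul]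
          exact le_add_of_nonneg_right (by positivity)
  · have hεc : ‖ε • c‖ ≤ ε := by
      rw [norm_smul, Real.norm_of_nonneg hε.le]
      exact mul_le_of_le_one_right hε.le hc
    have hz : ∀ z, ‖y - z‖ ≤ ‖y‖ / 4 → ‖y - (z + ε • c)‖ + R * ε ≤ ‖y‖ / 2 := by
      intro z hz
      rw [← sub_sub]
      have := norm_sub_le (y - z) (ε • c)
      linarith
    have := kernel_sub_le_of_far hk hkd hC₁ hk₁ (fun x hx => normDilate_eq_zero hε hR hx) hy
      (hz y (by rw [sub_self, norm_zero]; positivity)) (hz y' hyy)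
    rw [hbH, add_sub_add_right_eq_sub] at this
    calc _ ≤ _ := this
      _ = C₁ * 2 ^ (d + 1) * b * (‖y - y'‖ / ‖y‖ ^ (d + 1)) := by
          rw [div_pow]
          field_simp
      _ ≤ _ := by
          rw [add_mul]
          exact le_add_of_nonneg_left (by positivity)

end KernelEstimates

/-! ### The multiplier on `L¹ ∩ L²` and its smooth maximal function -/

section SquareIntegrable

lemma norm_integral_mul_le_of_bump {ι : Type*} [Fintype ι] {h φ : Eu ι → ℂ} {x : Eu ι}
    {C ε S B : ℝ} (hε : 0 < ε) (hS : 0 < S) (hB0 : 0 ≤ B)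
    (hh : ∀ r : ℝ, 0 < r → IntegrableOn h (closedBall x r) ∧
      ∫ y in closedBall x r, ‖h y‖ ≤ C * r ^ Fintype.card ι)
    (hB : ∀ u, ‖φ u‖ ≤ B / ε ^ Fintype.card ι) (hφ : ∀ u, S * ε < ‖u - x‖ → φ u = 0) :
    ‖∫ u, h u * φ u‖ ≤ B * C * S ^ Fintype.card ι := by
  obtain ⟨hi, hle⟩ := hh (S * ε) (by positivity)
  have h1 : ∫ u, h u * φ u = ∫ u in closedBall x (S * ε), h u * φ u := by
    rw [setIntegral_eq_integral_of_forall_compl_eq_zero]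
    intro u hu
    rw [mem_closedBall, dist_eq_norm, not_le] at hu
    rw [hφ u hu, mul_zero]
  rw [h1]
  calc _ ≤ ∫ u in closedBall x (S * ε), (B / ε ^ Fintype.card ι) * ‖h u‖ := by
        refine norm_integral_le_of_norm_le (hi.norm.const_mul _) (Eventually.of_forall fun u => ?_)
        rw [norm_mul, mul_comm]
        exact mul_le_mul_of_nonneg_right (hB u) (norm_nonneg _)
    _ ≤ (B / ε ^ Fintype.card ι) * (C * (S * ε) ^ Fintype.card ι) := by
        rw [integral_const_mul]
        exact mul_le_mul_of_nonneg_left hle (by positivity)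
    _ = _ := by
        rw [mul_pow]
        field_simp

variable {d : ℕ}

lemma integral_fourier_mul_eq {f g : Eu (Fin d) → ℂ} (hf : Integrable f) (hg : Integrable g) :
    ∫ ξ, 𝓕 f ξ * g ξ = ∫ x, f x * 𝓕 g x := by
  simpa using! (VectorFourier.integral_fourierIntegral_smul_eq_flip (L := innerₗ (Eu (Fin d)))
    Real.continuous_fourierChar continuous_inner hf hg)

/-- The integral transform and the Plancherel transform agree because both satisfy the
multiplication formula against every test function. -/
lemma fourier_ae_eq_Lp_fourier {G : Eu (Fin d) → ℂ} (hG : Integrable G) (hG2 : MemLp G 2) :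
    𝓕 G =ᵐ[volume] (𝓕 (hG2.toLp G) : Lp ℂ 2 (volume : Measure (Eu (Fin d)))) := by
  have hcont : Continuous (𝓕 G) :=
    VectorFourier.fourierIntegral_continuous Real.continuous_fourierChar
      (by exact continuous_inner) hG
  refine ae_eq_of_integral_contDiff_smul_eq hcont.locallyIntegrable
    ((Lp.memLp _).locallyIntegrable (by norm_num)) fun g hg hgc => ?_
  set ψ : 𝓢(Eu (Fin d), ℂ) := (hgc.comp_left (g := Complex.ofReal) rfl).toSchwartzMap
    (Complex.ofRealCLM.contDiff.comp hg)
  have hψ : ∀ x, ψ x = (g x : ℂ) := fun _ => rfl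
  have h1 := integral_fourier_mul_eq (ψ.integrable (μ := volume)) hG
  have h2 : (𝓕 (hG2.toLp G : 𝓢'(Eu (Fin d), ℂ))) ψ =
      Lp.toTemperedDistribution (𝓕 (hG2.toLp G) : Lp ℂ 2 (volume : Measure (Eu (Fin d)))) ψ := by
    rw [Lp.fourier_toTemperedDistribution_eq]
  rw [TemperedDistribution.fourier_apply, Lp.toTemperedDistribution_apply,
    Lp.toTemperedDistribution_apply] at h2
  have h3 : ∫ x, 𝓕 ψ x • hG2.toLp G x = ∫ x, 𝓕 ψ x * G x := by
    refine integral_congr_ae ?_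
    filter_upwards [hG2.coeFn_toLp] with x hx
    rw [hx, smul_eq_mul]
  rw [h3, SchwartzMap.fourier_coe, h1] at h2
  simpa only [hψ, smul_eq_mul, Complex.real_smul] using h2

variable {K : 𝓢'(Eu (Fin d), ℂ)} {m : Lp ℂ ∞ (volume : Measure (Eu (Fin d)))}

/-- A bounded Fourier multiplier maps `L¹ ∩ L²` into `L²`. -/
lemma exists_memLp_two_singularIntegral (hK : 𝓕 K = (m : 𝓢'(Eu (Fin d), ℂ)))
    {G : Eu (Fin d) → ℂ} (hG : Integrable G) (hG2 : MemLp G 2) :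
    ∃ h : Eu (Fin d) → ℂ, MemLp h 2 ∧
      ∀ φ : 𝓢(Eu (Fin d), ℂ), ∫ y, G y * K (shiftBy y φ) = ∫ y, h y * φ y := by
  set W₀ := (𝓕 (hG2.toLp G) : Lp ℂ 2 (volume : Measure (Eu (Fin d))))
  have hW : MemLp (fun ξ => m ξ * W₀ ξ) 2 (volume : Measure (Eu (Fin d))) :=
    (Lp.memLp W₀).mul (Lp.memLp m)
  set W : Lp ℂ 2 (volume : Measure (Eu (Fin d))) := hW.toLp _
  refine ⟨(𝓕⁻ W : Lp ℂ 2 (volume : Measure (Eu (Fin d)))), Lp.memLp _, fun φ => ?_⟩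
  have hpair : (𝓕 ((𝓕⁻ W : Lp ℂ 2 (volume : Measure (Eu (Fin d)))) : 𝓢'(Eu (Fin d), ℂ)))
      (𝓕⁻ φ) = Lp.toTemperedDistribution W (𝓕⁻ φ) := by
    rw [Lp.fourier_toTemperedDistribution_eq, FourierTransform.fourier_fourierInv_eq]
  rw [TemperedDistribution.fourier_apply, FourierTransform.fourier_fourierInv_eq,
    Lp.toTemperedDistribution_apply, Lp.toTemperedDistribution_apply] at hpair
  -- The witness is `𝓕⁻(m Ĝ)`: moving the Fourier transform from `𝓕⁻ φ · m` onto `G` produces `∫ 𝓕⁻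
  -- φ · m Ĝ`, and duality in `L²` moves the remaining inverse transform off `φ`.
  have h1 : ∀ y, K (shiftBy y φ) = 𝓕 (fun ξ => 𝓕⁻ φ ξ * m ξ) y := by
    intro y
    rw [kernel_shiftBy hK, Real.fourier_eq]
    refine integral_congr_ae (Eventually.of_forall fun ξ => ?_)
    simp only [Circle.smul_def, smul_eq_mul]
    rw [real_inner_comm]
  simp_rw [h1]
  have h2 := integral_fourier_mul_eq (integrable_fourierInv_mul φ m) hG
  calc ∫ y, G y * 𝓕 (fun ξ => 𝓕⁻ φ ξ * m ξ) y = ∫ y, 𝓕 (fun ξ => 𝓕⁻ φ ξ * m ξ) y * G y := by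
        simp_rw [mul_comm]
    _ = _ := h2
    _ = ∫ ξ, 𝓕⁻ φ ξ • W ξ := by
        refine integral_congr_ae ?_
        filter_upwards [hW.coeFn_toLp, fourier_ae_eq_Lp_fourier hG hG2] with ξ hξ hξ2
        rw [hξ, hξ2, smul_eq_mul, mul_assoc]
    _ = _ := by
        rw [← hpair]
        simp_rw [smul_eq_mul, mul_comm]

lemma exists_bound (H : 𝓢(Eu (Fin d), ℂ)) : ∃ B : ℝ, 0 ≤ B ∧ ∀ x, ‖H x‖ ≤ B := by
  obtain ⟨B, hB, h⟩ := H.decay 0 0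
  exact ⟨B, hB.le, fun x => by simpa using h x⟩

lemma shiftBy_add (x y : Eu (Fin d)) (φ : 𝓢(Eu (Fin d), ℂ)) :
    shiftBy (x + y) φ = shiftBy x (shiftBy y φ) := by
  ext z
  rw [shiftBy_apply, shiftBy_apply, shiftBy_apply]
  congr 1
  abel

/-- The non-tangential maximal function of the singular integral of an `L¹ ∩ L²` function is finite
almost everywhere. -/
lemma ae_exists_bound_of_memLp_two (hK : 𝓕 K = (m : 𝓢'(Eu (Fin d), ℂ)))
    {H : 𝓢(Eu (Fin d), ℂ)} (hH : HasCompactSupport H)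
    {G : Eu (Fin d) → ℂ} (hG : Integrable G) (hG2 : MemLp G 2) :
    ∀ᵐ x ∂(volume : Measure (Eu (Fin d))), ∃ C : ℝ, ∀ (ε : ℝ) (hε : 0 < ε) (c : Eu (Fin d)),
      ‖c‖ ≤ 1 → ‖∫ y, G y * K (shiftBy (y - x + ε • c) (normDilate ε hε H))‖ ≤ C := by
  obtain ⟨h, hh, hrep⟩ := exists_memLp_two_singularIntegral hK hG hG2
  obtain ⟨R, hR0, hR⟩ := exists_radius hH
  obtain ⟨B, hB0, hB⟩ := exists_bound H
  filter_upwards [ae_exists_setIntegral_norm_le (by norm_num) hh] with x ⟨C, hC, hx⟩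
  refine ⟨B * C * (R + 1) ^ Fintype.card (Fin d), fun ε hε c hc => ?_⟩
  have hεc : ‖ε • c‖ ≤ ε := by
    rw [norm_smul, Real.norm_of_nonneg hε.le]
    exact mul_le_of_le_one_right hε.le hc
  -- Separating the shift by `y` leaves one bump supported in a ball about `x` of radius `(R + 1)
  -- ε`, against which the `L²` representative is integrated.
  have h1 : ∀ y, shiftBy (y - x + ε • c) (normDilate ε hε H) =
      shiftBy y (shiftBy (ε • c - x) (normDilate ε hε H)) := by
    intro y
    rw [← shiftBy_add]
    congr 1
    abel
  simp_rw [h1]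
  rw [hrep]
  refine norm_integral_mul_le_of_bump hε (by positivity) hB0 hx (fun u => ?_) (fun u hu => ?_)
  · rw [shiftBy_apply, normDilate_apply, norm_mul, norm_inv, norm_pow, Complex.norm_real,
      Real.norm_of_nonneg hε.le, Fintype.card_fin, inv_mul_eq_div]
    gcongr
    exact hB _
  · rw [shiftBy_apply]
    refine normDilate_eq_zero hε hR ?_
    have h2 : ε • c - x + u = (u - x) + ε • c := by abel
    have h3 := norm_sub_le (u - x + ε • c) (ε • c)
    rw [add_sub_cancel_right] at h3
    rw [h2]
    linarith

end SquareIntegrable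

/-! ### Calderón–Zygmund splitting of a finite measure -/

section CalderonZygmund

variable {d : ℕ}

/-- The set of points at which the maximal function of `μ` is at most `l`. -/
def goodSet (μ : Measure (Eu (Fin d))) (l : ℝ) : Set (Eu (Fin d)) :=
  {x | ∀ r : ℝ, 0 < r → μ (closedBall x r) ≤ ENNReal.ofReal (l * r ^ d)}

/-- A ball of radius `r` about a limit point lies in a ball of radius `r + η` about a nearby good
point, and the bound is continuous in the radius. -/
lemma isClosed_goodSet (μ : Measure (Eu (Fin d))) (l : ℝ) : IsClosed (goodSet μ l) := by
  refine isClosed_of_closure_subset fun x hx r hr => ?_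
  have h1 : ∀ᶠ η in 𝓝[>] (0 : ℝ), μ (closedBall x r) ≤ ENNReal.ofReal (l * (r + η) ^ d) := by
    filter_upwards [self_mem_nhdsWithin] with η hη
    obtain ⟨y, hy, hxy⟩ := Metric.mem_closure_iff.1 hx η hη
    refine (measure_mono ?_).trans (hy (r + η) (add_pos hr hη))
    exact closedBall_subset_closedBall' (by linarith)
  have h2 : Tendsto (fun η : ℝ => ENNReal.ofReal (l * (r + η) ^ d)) (𝓝[>] 0)
      (𝓝 (ENNReal.ofReal (l * (r + 0) ^ d))) := by
    refine ENNReal.tendsto_ofReal ((Continuous.tendsto ?_ 0).mono_left nhdsWithin_le_nhds)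
    fun_prop
  rw [add_zero] at h2
  exact ge_of_tendsto h2 h1

lemma goodSet_mono (μ : Measure (Eu (Fin d))) {l l' : ℝ} (h : l ≤ l') :
    goodSet μ l ⊆ goodSet μ l' := fun x hx r hr =>
  (hx r hr).trans (ENNReal.ofReal_le_ofReal (by gcongr))

lemma ae_exists_mem_goodSet (μ : Measure (Eu (Fin d))) [IsFiniteMeasure μ] :
    ∀ᵐ x ∂(volume : Measure (Eu (Fin d))), ∃ n : ℕ, x ∈ goodSet μ n := by
  filter_upwards [ae_exists_closedBall_le_of_finite μ] with x ⟨C, hC, hx⟩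
  obtain ⟨n, hn⟩ := exists_nat_ge C
  refine ⟨n, goodSet_mono μ hn fun r hr => ?_⟩
  simpa using hx r hr

lemma restrict_goodSet_le (μ : Measure (Eu (Fin d))) [IsFiniteMeasure μ] (l : ℝ) :
    ∃ a : ℝ≥0, μ.restrict (goodSet μ l) ≤ a • volume := by
  set c := volume.real (closedBall (0 : Eu (Fin d)) 1)
  have hc : 0 < c := volume_unit_closedBall_pos
  refine ⟨(l / c).toNNReal, Measure.le_iff.2 fun s hs => ?_⟩
  rw [Measure.restrict_apply hs]
  refine le_trans ?_ (measure_mono (inter_subset_left (t := goodSet μ l)))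
  -- Covering with respect to `μ` itself makes the required absolute continuity trivial; the
  -- absolute continuity of `μ` with respect to Lebesgue measure on the good set is then a
  -- consequence.
  refine (Besicovitch.vitaliFamily μ).measure_le_of_frequently_le _ Measure.AbsolutelyContinuous.rfl
    _ fun x hx => ?_
  refine (Besicovitch.tendsto_filterAt μ x).frequently (Eventually.frequently ?_)
  filter_upwards [self_mem_nhdsWithin] with r hr
  rw [mem_Ioi] at hr
  rw [Measure.smul_apply, volume_closedBall_eq x hr.le, ENNReal.smul_def, smul_eq_mul,
    Fintype.card_fin]
  refine (hx.2 r hr).trans ?_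
  change _ ≤ ENNReal.ofReal (l / c) * _
  rw [← ENNReal.ofReal_mul' (by positivity)]
  refine ENNReal.ofReal_le_ofReal (le_of_eq ?_)
  rw [← mul_assoc, div_mul_cancel₀ _ hc.ne']

/-- A quarter of the distance to `F`. -/
noncomputable def whitneyRadius (F : Set (Eu (Fin d))) (y : Eu (Fin d)) : ℝ := infDist y F / 4

/-- The density at `z` of the uniform probability measure on the ball around `y` whose radius is the
Whitney radius of `y`. -/
noncomputable def smear (F : Set (Eu (Fin d))) (y z : Eu (Fin d)) : ℝ :=
  if dist z y < whitneyRadius F y then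
    (volume.real (ball (0 : Eu (Fin d)) 1) * whitneyRadius F y ^ d)⁻¹ else 0

/-- A Poisson-like kernel, of which the width at `y` is the Whitney radius of `y`. -/
noncomputable def tailKernel (F : Set (Eu (Fin d))) (y x : Eu (Fin d)) : ℝ :=
  whitneyRadius F y * ((whitneyRadius F y + ‖x - y‖) ^ (d + 1))⁻¹

variable {F : Set (Eu (Fin d))}

lemma whitneyRadius_nonneg (y : Eu (Fin d)) : 0 ≤ whitneyRadius F y := by
  have := infDist_nonneg (x := y) (s := F)
  unfold whitneyRadius
  positivity

lemma continuous_whitneyRadius : Continuous (whitneyRadius F) := by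
  have := continuous_infDist_pt F
  unfold whitneyRadius
  fun_prop

lemma whitneyRadius_le_dist {x y : Eu (Fin d)} (hx : x ∈ F) : whitneyRadius F y ≤ dist y x / 4 := by
  have := infDist_le_dist_of_mem (x := y) hx
  unfold whitneyRadius
  linarith

lemma whitneyRadius_le_add (y z : Eu (Fin d)) :
    whitneyRadius F y ≤ whitneyRadius F z + dist y z / 4 := by
  have := infDist_le_infDist_add_dist (s := F) (x := y) (y := z)
  unfold whitneyRadius
  linarith

lemma whitneyRadius_pos (hF : IsClosed F) (hne : F.Nonempty) {y : Eu (Fin d)} (hy : y ∉ F) :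
    0 < whitneyRadius F y := by
  have := (hF.notMem_iff_infDist_pos hne).1 hy
  unfold whitneyRadius
  linarith

lemma smear_nonneg (y z : Eu (Fin d)) : 0 ≤ smear F y z := by
  have := whitneyRadius_nonneg (F := F) y
  unfold smear
  split_ifs <;> positivity

lemma tailKernel_nonneg (y z : Eu (Fin d)) : 0 ≤ tailKernel F y z := by
  have := whitneyRadius_nonneg (F := F) y
  unfold tailKernel
  positivity

lemma measurable_smear : Measurable fun w : Eu (Fin d) × Eu (Fin d) => smear F w.1 w.2 := by
  have hr := (continuous_whitneyRadius (F := F)).measurable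
  unfold smear
  refine Measurable.ite (measurableSet_lt (by fun_prop) (by fun_prop)) (by fun_prop) (by fun_prop)

lemma measurable_tailKernel :
    Measurable fun w : Eu (Fin d) × Eu (Fin d) => tailKernel F w.1 w.2 := by
  have hr := (continuous_whitneyRadius (F := F)).measurable
  unfold tailKernel
  fun_prop

lemma volume_unit_ball_pos : 0 < volume.real (ball (0 : Eu (Fin d)) 1) :=
  ENNReal.toReal_pos (measure_ball_pos _ _ one_pos).ne' measure_ball_lt_top.ne

lemma smear_eq_indicator (y : Eu (Fin d)) :
    smear F y = (ball y (whitneyRadius F y)).indicator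
      fun _ => (volume.real (ball (0 : Eu (Fin d)) 1) * whitneyRadius F y ^ d)⁻¹ := by
  ext z
  by_cases h : dist z y < whitneyRadius F y
  · rw [indicator_of_mem (by exact h), smear, if_pos h]
  · rw [indicator_of_notMem (by exact h), smear, if_neg h]

lemma integrable_smear (y : Eu (Fin d)) : Integrable (smear F y) := by
  rw [smear_eq_indicator, integrable_indicator_iff measurableSet_ball]
  exact integrableOn_const measure_ball_lt_top.ne

lemma integral_smear {y : Eu (Fin d)} (hy : 0 < whitneyRadius F y) : ∫ z, smear F y z = 1 := by
  rw [smear_eq_indicator, integral_indicator measurableSet_ball, setIntegral_const, measureReal_def,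
    Measure.addHaar_ball_of_pos _ _ hy, ENNReal.toReal_mul, ENNReal.toReal_ofReal (by positivity),
    finrank_euclideanSpace, Fintype.card_fin, ← measureReal_def, smul_eq_mul, mul_comm (_ ^ d)]
  have := volume_unit_ball_pos (d := d)
  exact mul_inv_cancel₀ (by positivity)

lemma integral_smear_le (y : Eu (Fin d)) : ∫ z, smear F y z ≤ 1 := by
  rcases (whitneyRadius_nonneg (F := F) y).lt_or_eq with h | h
  · exact (integral_smear h).le
  · have : smear F y = 0 := by
      rw [smear_eq_indicator, ← h, ball_zero, indicator_empty]
      rfl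
    rw [this]
    simp

lemma integrable_prod_smear (μ : Measure (Eu (Fin d))) [IsFiniteMeasure μ] :
    Integrable (fun w : Eu (Fin d) × Eu (Fin d) => smear F w.1 w.2) (μ.prod volume) := by
  have hm := (measurable_smear (F := F)).aestronglyMeasurable (μ := μ.prod volume)
  rw [integrable_prod_iff hm]
  refine ⟨Eventually.of_forall integrable_smear, ?_⟩
  refine (integrable_const (1 : ℝ)).mono' hm.norm.integral_prod_right' ?_
  refine Eventually.of_forall fun y => ?_
  simp_rw [Real.norm_of_nonneg (smear_nonneg y _)]
  rw [Real.norm_of_nonneg (integral_nonneg (smear_nonneg y))]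
  exact integral_smear_le y

lemma tailKernel_rescale {y : Eu (Fin d)} (hy : 0 < whitneyRadius F y) (x : Eu (Fin d)) :
    tailKernel F y x = (whitneyRadius F y ^ d)⁻¹ *
      (1 + ‖(whitneyRadius F y)⁻¹ • (x - y)‖) ^ (-(d + 1 : ℝ)) := by
  rw [tailKernel, norm_smul, norm_inv, Real.norm_of_nonneg hy.le, Real.rpow_neg (by positivity)]
  have : ∀ a : ℝ, a ^ ((d : ℝ) + 1) = a ^ (d + 1) := fun a => by
    rw [← Real.rpow_natCast]; push_cast; rfl
  rw [this]
  have h2 : whitneyRadius F y + ‖x - y‖ =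
      whitneyRadius F y * (1 + (whitneyRadius F y)⁻¹ * ‖x - y‖) := by
    field_simp
  rw [h2, mul_pow]
  field_simp
  ring

/-- In `x` the kernel is an `L¹`-normalised dilate of `(1 + |v|)^{-(d+1)}`, so its integral is
bounded independently of `y`. It vanishes identically when the Whitney radius is zero. -/
lemma integrable_and_integral_tailKernel (F : Set (Eu (Fin d))) (y : Eu (Fin d)) :
    Integrable (tailKernel F y) ∧
      ∫ x, tailKernel F y x ≤ ∫ v : Eu (Fin d), (1 + ‖v‖) ^ (-(d + 1 : ℝ)) := by
  have hP : Integrable fun v : Eu (Fin d) => (1 + ‖v‖) ^ (-(d + 1 : ℝ)) :=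
    integrable_one_add_norm (by rw [finrank_euclideanSpace, Fintype.card_fin]; linarith)
  rcases (whitneyRadius_nonneg (F := F) y).lt_or_eq with h | h
  · have he : tailKernel F y = fun x => (whitneyRadius F y ^ d)⁻¹ *
      (1 + ‖(whitneyRadius F y)⁻¹ • (x - y)‖) ^ (-(d + 1 : ℝ)) := funext (tailKernel_rescale h)
    rw [he]
    refine ⟨Integrable.const_mul ?_ _, ?_⟩
    · exact (hP.comp_smul (inv_ne_zero h.ne')).comp_sub_right y
    · rw [integral_const_mul, integral_sub_right_eq_self
        (fun x => (1 + ‖(whitneyRadius F y)⁻¹ • x‖) ^ (-(d + 1 : ℝ))) y,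
        Measure.integral_comp_inv_smul volume (fun v : Eu (Fin d) => (1 + ‖v‖) ^ (-(d + 1 : ℝ))),
        finrank_euclideanSpace, Fintype.card_fin, abs_of_pos (by positivity), smul_eq_mul,
        inv_mul_cancel_left₀ (by positivity)]
  · have : tailKernel F y = 0 := by
      ext x
      rw [tailKernel, ← h, zero_mul]
      rfl
    rw [this]
    refine ⟨integrable_zero _ _ _, ?_⟩
    simp only [Pi.zero_apply, integral_zero]
    positivity

/-- Marcinkiewicz's argument: the integral in `x` is bounded uniformly in `y` and `μ` is finite, so
Fubini gives integrability in `y` for almost every `x`. -/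
lemma ae_integrable_tailKernel (F : Set (Eu (Fin d))) (μ : Measure (Eu (Fin d)))
    [IsFiniteMeasure μ] :
    ∀ᵐ x ∂(volume : Measure (Eu (Fin d))), Integrable (fun y => tailKernel F y x) μ := by
  have hm := (measurable_tailKernel (F := F)).aestronglyMeasurable (μ := μ.prod volume)
  have : Integrable (fun w : Eu (Fin d) × Eu (Fin d) => tailKernel F w.1 w.2) (μ.prod volume) := by
    rw [integrable_prod_iff hm]
    refine ⟨Eventually.of_forall fun y => (integrable_and_integral_tailKernel F y).1, ?_⟩
    refine (integrable_const (∫ v : Eu (Fin d), (1 + ‖v‖) ^ (-(d + 1 : ℝ)))).mono'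
      hm.norm.integral_prod_right' ?_
    refine Eventually.of_forall fun y => ?_
    simp_rw [Real.norm_of_nonneg (tailKernel_nonneg y _)]
    rw [Real.norm_of_nonneg (integral_nonneg (tailKernel_nonneg y))]
    exact (integrable_and_integral_tailKernel F y).2
  exact this.prod_left_ae

/-- Whitney radii are comparable whenever `z` lies in the ball of `y`. All contributing `y`
therefore lie in one ball, of radius comparable to that at `z`, about a good point, and there the
mass is at most `l` times the power of the radius. -/
lemma integral_smear_left_le {μ ν : Measure (Eu (Fin d))} [IsFiniteMeasure ν] (hν : ν ≤ μ) {l : ℝ}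
    (hl : 0 ≤ l) (hne : (goodSet μ l).Nonempty) (z : Eu (Fin d)) :
    ∫ y, smear (goodSet μ l) y z ∂ν ≤
      l * 7 ^ d / (volume.real (ball (0 : Eu (Fin d)) 1) * (4 / 5) ^ d) := by
  set F := goodSet μ l
  set c := volume.real (ball (0 : Eu (Fin d)) 1)
  have hc : 0 < c := volume_unit_ball_pos
  set r := whitneyRadius F z with hr
  have hr0 : 0 ≤ r := whitneyRadius_nonneg z
  have hcomp : ∀ y, dist z y < whitneyRadius F y →
      whitneyRadius F y ≤ 4 / 3 * r ∧ 4 / 5 * r ≤ whitneyRadius F y := by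
    intro y hy
    have h1 := whitneyRadius_le_add (F := F) y z
    have h2 := whitneyRadius_le_add (F := F) z y
    rw [dist_comm y z] at h1
    constructor <;> linarith
  rcases hr0.lt_or_eq with hpos | h0
  -- The distance from `z` to `F` is `4r`, so `5r` leaves room for a point that need not realise it.
  -- Adding `dist y z < 4r/3` stays below `7r`.
  · obtain ⟨p, hp, hzp⟩ : ∃ p ∈ F, dist z p < 5 * r := by
      refine (infDist_lt_iff hne).1 ?_
      have : infDist z F = 4 * r := by rw [hr, whitneyRadius]; ring
      linarith
    have hsm : ∀ y, smear F y z ≤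
        (closedBall p (7 * r)).indicator (fun _ => (c * (4 / 5 * r) ^ d)⁻¹) y := by
      intro y
      by_cases hy : dist z y < whitneyRadius F y
      · obtain ⟨h1, h2⟩ := hcomp y hy
        rw [indicator_of_mem, smear, if_pos hy]
        · gcongr
        · rw [mem_closedBall]
          have := dist_triangle y z p
          rw [dist_comm y z] at this
          linarith
      · rw [smear, if_neg hy]
        exact indicator_nonneg (fun _ _ => by positivity) _
    calc ∫ y, smear F y z ∂ν
        ≤ ∫ y, (closedBall p (7 * r)).indicator (fun _ => (c * (4 / 5 * r) ^ d)⁻¹) y ∂ν := by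
          refine integral_mono_of_nonneg (Eventually.of_forall fun y => smear_nonneg y z) ?_
            (Eventually.of_forall hsm)
          exact (integrable_const _).indicator measurableSet_closedBall
      _ = ν.real (closedBall p (7 * r)) * (c * (4 / 5 * r) ^ d)⁻¹ := by
          rw [integral_indicator measurableSet_closedBall, setIntegral_const, smul_eq_mul]
      _ ≤ (l * (7 * r) ^ d) * (c * (4 / 5 * r) ^ d)⁻¹ := by
          gcongr
          exact ENNReal.toReal_le_of_le_ofReal (by positivity)
            ((hν _).trans (hp (7 * r) (by positivity)))
      _ = _ := by
          rw [mul_pow, mul_pow (4 / 5)]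
          field_simp
  · have : ∀ y, smear F y z = 0 := by
      intro y
      rw [smear, if_neg]
      intro hy
      have h1 := (hcomp y hy).1
      rw [← h0] at h1
      linarith [dist_nonneg (x := z) (y := y)]
    simp_rw [this]
    rw [integral_zero]
    positivity

lemma memLp_two_of_bounded {g : Eu (Fin d) → ℝ} (hg : Integrable g) {C : ℝ}
    (hC : ∀ᵐ x ∂(volume : Measure (Eu (Fin d))), ‖g x‖ ≤ C) : MemLp g 2 volume := by
  rw [memLp_two_iff_integrable_sq hg.aestronglyMeasurable]
  refine (hg.norm.const_mul C).mono' (hg.aestronglyMeasurable.pow 2) ?_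
  filter_upwards [hC] with x hx
  rw [norm_pow, sq]
  gcongr

/-- The Calderón–Zygmund splitting of a finite measure `μ`: up to the tail of `μ` around the good
set, the measure acts on regular kernels like a square integrable function. -/
lemma exists_good_density (μ : Measure (Eu (Fin d))) [IsFiniteMeasure μ] {l : ℝ} (hl : 0 ≤ l)
    (hne : (goodSet μ l).Nonempty) :
    ∃ g : Eu (Fin d) → ℝ, Integrable g ∧ MemLp g 2 volume ∧
      ∀ (κ : Eu (Fin d) → ℂ) (B C : ℝ) (x : Eu (Fin d)), Continuous κ → (∀ y, ‖κ y‖ ≤ B) →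
        0 ≤ C → x ∈ goodSet μ l →
        (∀ y y', y ≠ x → ‖y - y'‖ ≤ ‖y - x‖ / 4 →
          ‖κ y - κ y'‖ ≤ C * (‖y - y'‖ / ‖y - x‖ ^ (d + 1))) →
        Integrable (fun y => tailKernel (goodSet μ l) y x) μ →
        ‖∫ y, κ y ∂μ‖ ≤ ‖∫ z, (g z : ℂ) * κ z‖ +
          C * 2 ^ (d + 1) * ∫ y, tailKernel (goodSet μ l) y x ∂μ := by
  set F := goodSet μ l with hFdef
  have hF : IsClosed F := isClosed_goodSet μ l
  obtain ⟨a, ha⟩ := restrict_goodSet_le μ l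
  have hac : μ.restrict F ≪ volume :=
    (Measure.absolutelyContinuous_of_le ha).trans (Measure.smul_absolutelyContinuous)
  set g₁ : Eu (Fin d) → ℝ := fun z => ((μ.restrict F).rnDeriv volume z).toReal
  have hg₁ : Integrable g₁ := Measure.integrable_toReal_rnDeriv
  have hg₁b : ∀ᵐ z ∂(volume : Measure (Eu (Fin d))), ‖g₁ z‖ ≤ a := by
    have h1 : ∀ᵐ z ∂(volume : Measure (Eu (Fin d))), (μ.restrict F).rnDeriv volume z ≤ a := by
      refine ae_le_of_forall_setLIntegral_le_of_sigmaFinite₀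
        (Measure.measurable_rnDeriv _ _).aemeasurable fun s hs _ => ?_
      rw [Measure.setLIntegral_rnDeriv hac, setLIntegral_const]
      exact ha s
    filter_upwards [h1] with z hz
    rw [Real.norm_of_nonneg ENNReal.toReal_nonneg]
    exact ENNReal.toReal_le_of_le_ofReal a.coe_nonneg (by simpa using hz)
  set μ' := μ.restrict Fᶜ
  set g₂ : Eu (Fin d) → ℝ := fun z => ∫ y, smear F y z ∂μ'
  have hprod := integrable_prod_smear (F := F) μ'
  have hg₂ : Integrable g₂ := hprod.integral_prod_right
  obtain ⟨b, hb⟩ : ∃ b : ℝ, ∀ z, ‖g₂ z‖ ≤ b :=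
    ⟨l * 7 ^ d / (volume.real (ball (0 : Eu (Fin d)) 1) * (4 / 5) ^ d), fun z => by
      rw [Real.norm_of_nonneg (integral_nonneg fun y => smear_nonneg y z)]
      exact integral_smear_left_le Measure.restrict_le_self hl hne z⟩
  refine ⟨fun z => g₁ z + g₂ z, hg₁.add hg₂, (memLp_two_of_bounded hg₁ hg₁b).add
    (memLp_two_of_bounded hg₂ (Eventually.of_forall hb)), ?_⟩
  intro κ B C x hκ hB hC hx hreg htail
  have hκi : ∀ ν : Measure (Eu (Fin d)), IsFiniteMeasure ν → Integrable κ ν := fun ν _ =>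
    Integrable.of_bound hκ.aestronglyMeasurable B (Eventually.of_forall hB)
  have hgκ : ∀ g : Eu (Fin d) → ℝ, Integrable g → Integrable fun z => (g z : ℂ) * κ z := by
    intro g hg
    exact hg.ofReal.mul_bdd (c := B) hκ.aestronglyMeasurable (Eventually.of_forall hB)
  have hsκ : ∀ y, Integrable fun z => (smear F y z : ℂ) * κ z := fun y =>
    hgκ _ (integrable_smear y)
  have hprodκ : Integrable (fun w : Eu (Fin d) × Eu (Fin d) => (smear F w.1 w.2 : ℂ) * κ w.2)
      (μ'.prod volume) :=
    hprod.ofReal.mul_bdd (c := B) (hκ.comp continuous_snd).aestronglyMeasurable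
      (Eventually.of_forall fun w => hB _)
  have h1 : ∫ y, κ y ∂μ = ∫ y, κ y ∂(μ.restrict F) + ∫ y, κ y ∂μ' :=
    (integral_add_compl hF.measurableSet (hκi μ inferInstance)).symm
  have h2 : ∫ y, κ y ∂(μ.restrict F) = ∫ z, (g₁ z : ℂ) * κ z := by
    rw [← integral_rnDeriv_smul hac]
    simp_rw [Complex.real_smul]
    rfl
  have h3 : ∫ z, (g₂ z : ℂ) * κ z = ∫ y, (∫ z, (smear F y z : ℂ) * κ z) ∂μ' := by
    rw [integral_integral_swap hprodκ]
    refine integral_congr_ae (Eventually.of_forall fun z => ?_)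
    simp only [g₂]
    rw [integral_mul_const, integral_complex_ofReal]
  have h4 : ‖∫ y, (κ y - ∫ z, (smear F y z : ℂ) * κ z) ∂μ'‖ ≤
      C * 2 ^ (d + 1) * ∫ y, tailKernel F y x ∂μ := by
    refine le_trans ?_ (mul_le_mul_of_nonneg_left (setIntegral_le_integral (s := Fᶜ) htail
      (Eventually.of_forall fun y => tailKernel_nonneg y x)) (by positivity : 0 ≤ C * 2 ^ (d + 1)))
    rw [← integral_const_mul]
    refine norm_integral_le_of_norm_le (htail.restrict.const_mul _) ?_
    filter_upwards [ae_restrict_mem hF.measurableSet.compl] with y hy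
    have hr := whitneyRadius_pos hF hne hy
    have hyx : y ≠ x := fun h => hy (h ▸ hx)
    have hyx0 : 0 < ‖y - x‖ := norm_pos_iff.2 (sub_ne_zero.2 hyx)
    have hrx := whitneyRadius_le_dist (y := y) hx
    rw [dist_eq_norm] at hrx
    -- The smear is a probability density on a ball of radius at most `‖y - x‖/4`, so the error is
    -- an average of differences to which the regularity hypothesis applies.
    have he : κ y - ∫ z, (smear F y z : ℂ) * κ z = ∫ z, (smear F y z : ℂ) * (κ y - κ z) := by
      have hi : Integrable fun z => (smear F y z : ℂ) * κ y :=
        (integrable_smear y).ofReal.mul_const _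
      simp_rw [mul_sub]
      rw [integral_sub hi (hsκ y), integral_mul_const,
        integral_complex_ofReal, integral_smear hr, Complex.ofReal_one, one_mul]
    rw [he]
    calc _ ≤ ∫ z, smear F y z * (C * (whitneyRadius F y / ‖y - x‖ ^ (d + 1))) := by
          refine norm_integral_le_of_norm_le ((integrable_smear y).mul_const _)
            (Eventually.of_forall fun z => ?_)
          rw [norm_mul, Complex.norm_real, Real.norm_of_nonneg (smear_nonneg y z)]
          by_cases hz : dist z y < whitneyRadius F y
          · refine mul_le_mul_of_nonneg_left ?_ (smear_nonneg y z)
            rw [dist_comm, dist_eq_norm] at hz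
            refine (hreg y z hyx (by linarith)).trans ?_
            gcongr
          · rw [smear, if_neg hz, zero_mul, zero_mul]
      _ = C * (whitneyRadius F y / ‖y - x‖ ^ (d + 1)) := by
          rw [integral_mul_const, integral_smear hr, one_mul]
      -- Since `x ∈ F`, the Whitney radius plus `‖x - y‖` is at most `2‖y - x‖`; this is the source
      -- of `2 ^ (d + 1)`.
      _ = C * 2 ^ (d + 1) * (whitneyRadius F y * ((2 * ‖y - x‖) ^ (d + 1))⁻¹) := by
          rw [mul_pow]
          field_simp
      _ ≤ _ := by
          rw [tailKernel, norm_sub_rev x y]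
          gcongr
          linarith
  have h5 : ∫ y, κ y ∂μ = (∫ z, ((g₁ z + g₂ z : ℝ) : ℂ) * κ z) +
      ∫ y, (κ y - ∫ z, (smear F y z : ℂ) * κ z) ∂μ' := by
    rw [integral_sub (hκi μ' inferInstance) hprodκ.integral_prod_left, h1, h2]
    change _ = _ + (_ - ∫ y, (∫ z, (smear F y z : ℂ) * κ z) ∂μ')
    rw [← h3]
    simp_rw [Complex.ofReal_add, add_mul]
    rw [integral_add (hgκ _ hg₁) (hgκ _ hg₂)]
    ring
  rw [h5]
  exact (norm_add_le _ _).trans (by gcongr)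

variable {K : 𝓢'(Eu (Fin d), ℂ)}

/-- On each good set the square integrable density and the tail give a bound free of `ε` and `c`,
because the regularity constant is. Countably many good sets cover almost every point. The
off-centre parameter `c` later absorbs the shift `ξ₁/2`. -/
lemma ae_exists_bound_measure (hK : IsFundamentalKernel K) {H : 𝓢(Eu (Fin d), ℂ)}
    (hH : HasCompactSupport H) (μ : Measure (Eu (Fin d))) [IsFiniteMeasure μ] :
    ∀ᵐ x ∂(volume : Measure (Eu (Fin d))), ∃ C : ℝ, ∀ (ε : ℝ) (hε : 0 < ε) (c : Eu (Fin d)),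
      ‖c‖ ≤ 1 → ‖∫ y, K (shiftBy (y - x + ε • c) (normDilate ε hε H)) ∂μ‖ ≤ C := by
  obtain ⟨m, hm⟩ := hK.fourier_bounded
  obtain ⟨A, hA, hreg⟩ := exists_kernel_regularity hK hH
  have key : ∀ n : ℕ, ∀ᵐ x ∂(volume : Measure (Eu (Fin d))), x ∈ goodSet μ n →
      ∃ C : ℝ, ∀ (ε : ℝ) (hε : 0 < ε) (c : Eu (Fin d)),
      ‖c‖ ≤ 1 → ‖∫ y, K (shiftBy (y - x + ε • c) (normDilate ε hε H)) ∂μ‖ ≤ C := by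
    intro n
    rcases (goodSet μ n).eq_empty_or_nonempty with h | hne
    · simp [h]
    obtain ⟨g, hg, hg2, hsplit⟩ := exists_good_density μ n.cast_nonneg hne
    filter_upwards [ae_exists_bound_of_memLp_two hm hH hg.ofReal hg2.ofReal,
      ae_integrable_tailKernel (goodSet μ n) μ] with x ⟨C, hC⟩ htail hx
    refine ⟨C + A * 2 ^ (d + 1) * ∫ y, tailKernel (goodSet μ n) y x ∂μ, fun ε hε c hc => ?_⟩
    refine (hsplit (fun y => K (shiftBy (y - x + ε • c) (normDilate ε hε H))) _ A x ?_
      (fun y => norm_kernel_shiftBy_le hm _ _) hA hx (fun y y' hy hyy => ?_) htail).trans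
      (add_le_add_left (hC ε hε c hc) _)
    · exact (continuous_kernel_shiftBy hm _).comp (by fun_prop)
    · have := hreg ε hε c (y - x) (y' - x) hc (sub_ne_zero.2 hy)
      rw [sub_sub_sub_cancel_right] at this
      exact this hyy
  filter_upwards [ae_exists_mem_goodSet μ, ae_all_iff.2 key] with x ⟨n, hn⟩ h
  exact h n hn

/-- The non-tangential smooth maximal function of the singular integral of a finite signed measure
is finite almost everywhere. -/
lemma ae_exists_bound_singularIntegral (hK : IsFundamentalKernel K) {H : 𝓢(Eu (Fin d), ℂ)}
    (hH : HasCompactSupport H) (g : SignedMeasure (Eu (Fin d))) :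
    ∀ᵐ x ∂(volume : Measure (Eu (Fin d))), ∃ C : ℝ, ∀ (ε : ℝ) (hε : 0 < ε) (c : Eu (Fin d)),
      ‖c‖ ≤ 1 → ‖singularIntegral K g (shiftBy (ε • c - x) (normDilate ε hε H))‖ ≤ C := by
  filter_upwards [ae_exists_bound_measure hK hH g.toJordanDecomposition.posPart,
    ae_exists_bound_measure hK hH g.toJordanDecomposition.negPart] with x ⟨C, hC⟩ ⟨C', hC'⟩
  refine ⟨C + C', fun ε hε c hc => ?_⟩
  have h1 : ∀ y, shiftBy y (shiftBy (ε • c - x) (normDilate ε hε H)) =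
      shiftBy (y - x + ε • c) (normDilate ε hε H) := by
    intro y
    rw [← shiftBy_add]
    congr 1
    abel
  simp only [singularIntegral, signedIntegral, h1]
  exact (norm_sub_le _ _).trans (add_le_add (hC ε hε c hc) (hC' ε hε c hc))

end CalderonZygmund

/-! ### Dependence of mollifications on the scale -/

section Mollification

variable {ι : Type*} [Fintype ι]

/-- When `N` is the dimension, the bracket is `div(w Φ(w))` at `w = s⁻¹ v`; this divergence form is
what makes integration by parts possible. -/
lemma hasDerivAt_rescale {Φ : Eu ι → ℝ} (hΦ : ContDiff ℝ 1 Φ) (N : ℕ) (v : Eu ι) {s : ℝ}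
    (hs : 0 < s) :
    HasDerivAt (fun s : ℝ => (s ^ N)⁻¹ * Φ (s⁻¹ • v))
      (-((s ^ (N + 1))⁻¹ * (N * Φ (s⁻¹ • v) + fderiv ℝ Φ (s⁻¹ • v) (s⁻¹ • v)))) s := by
  have h1 : HasDerivAt (fun s : ℝ => (s ^ N)⁻¹) (-(N * (s ^ (N + 1))⁻¹)) s := by
    refine ((hasDerivAt_pow N s).inv (pow_ne_zero _ hs.ne')).congr_deriv ?_
    -- The power rule carries the truncated exponent `N - 1`, so `N = 0` is separate.
    rcases N with _ | N
    · simp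
    · simp only [Nat.add_sub_cancel]
      field_simp
      ring
  have h2 : HasDerivAt (fun s : ℝ => s⁻¹ • v) (-(s ^ 2)⁻¹ • v) s :=
    (hasDerivAt_inv hs.ne').smul_const v
  have h3 := ((hΦ.differentiable (by simp)) (s⁻¹ • v)).hasFDerivAt.comp_hasDerivAt s h2
  refine (h1.mul h3).congr_deriv ?_
  have h4 : -(s ^ 2)⁻¹ • v = -s⁻¹ • (s⁻¹ • v) := by
    rw [smul_smul]
    congr 1
    field_simp
  rw [h4, map_smul, smul_eq_mul, Function.comp_apply]
  field_simp
  ring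

/-- The operator norm bound `‖x - z‖ ≤ ρ s` on the support of `z ↦ Φ (s⁻¹ L (x - z))`. -/
lemma exists_support_radius (L : Eu ι ≃L[ℝ] Eu ι) {P : Eu ι → ℝ} (hP : HasCompactSupport P) :
    ∃ ρ : ℝ, 0 < ρ ∧ ∀ (s : ℝ), 0 < s → ∀ x z, ρ * s < ‖z - x‖ → P (s⁻¹ • L (x - z)) = 0 := by
  obtain ⟨R, hR⟩ := hP.isCompact.isBounded.subset_closedBall 0
  set c := ‖(L.symm : Eu ι →L[ℝ] Eu ι)‖
  refine ⟨c * |R| + 1, by positivity, fun s hs x z hz => ?_⟩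
  by_contra h
  have h1 := hR (subset_tsupport _ h)
  rw [mem_closedBall_zero_iff, norm_smul, norm_inv, Real.norm_of_nonneg hs.le,
    inv_mul_le_iff₀ hs] at h1
  have h2 : ‖x - z‖ ≤ c * ‖L (x - z)‖ := by
    have := (L.symm : Eu ι →L[ℝ] Eu ι).le_opNorm (L (x - z))
    simpa using this
  rw [norm_sub_rev] at hz
  have h3 : c * ‖L (x - z)‖ ≤ c * (s * |R|) := by
    gcongr
    exact h1.trans (by gcongr; exact le_abs_self R)
  nlinarith

lemma integrable_mul_rescale {f : Eu ι → ℝ} (hf : LocallyIntegrable f) {P : Eu ι → ℝ}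
    (hP : Continuous P) (hPc : HasCompactSupport P) (L : Eu ι ≃L[ℝ] Eu ι) (x : Eu ι) {s : ℝ}
    (hs : 0 < s) : Integrable fun z => f z * P (s⁻¹ • L (x - z)) := by
  obtain ⟨ρ, -, hρ⟩ := exists_support_radius L hPc
  have hg : HasCompactSupport fun z => P (s⁻¹ • L (x - z)) := by
    refine HasCompactSupport.of_support_subset_isCompact (isCompact_closedBall x (ρ * s))
      fun z hz => ?_
    rw [mem_closedBall, dist_eq_norm]
    by_contra! h
    exact hz (hρ s hs x z h)
  exact hf.integrable_smul_right_of_hasCompactSupport (by fun_prop) hg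

/-- Differentiation in the scale `s` of the mollification of a locally integrable function. -/
lemma hasDerivAt_mollified {f : Eu ι → ℝ} (hf : LocallyIntegrable f) {Φ : Eu ι → ℝ}
    (hΦ : ContDiff ℝ 1 Φ) (hc : HasCompactSupport Φ) (L : Eu ι ≃L[ℝ] Eu ι) (x : Eu ι) (N : ℕ)
    {s : ℝ} (hs : 0 < s) :
    HasDerivAt (fun s : ℝ => ∫ z, f z * ((s ^ N)⁻¹ * Φ (s⁻¹ • L (x - z))))
      (∫ z, f z * -((s ^ (N + 1))⁻¹ * (N * Φ (s⁻¹ • L (x - z)) +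
        fderiv ℝ Φ (s⁻¹ • L (x - z)) (s⁻¹ • L (x - z))))) s := by
  set P : Eu ι → ℝ := fun w => N * Φ w + fderiv ℝ Φ w w with hPdef
  have hP : Continuous P := by
    have h1 := hΦ.continuous
    have h2 := hΦ.continuous_fderiv (by simp)
    fun_prop
  have hPc : HasCompactSupport P := by
    refine HasCompactSupport.add (hc.mul_left) ?_
    refine (hc.fderiv ℝ).mono fun w hw => ?_
    rw [Function.mem_support] at hw ⊢
    intro h
    exact hw (by simp [h])
  obtain ⟨ρ, hρ0, hρ⟩ := exists_support_radius L hPc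
  obtain ⟨B, hB⟩ := hPc.exists_bound_of_continuous hP
  have hB0 : 0 ≤ B := (norm_nonneg _).trans (hB 0)
  have hint : ∀ {Q : Eu ι → ℝ}, Continuous Q → HasCompactSupport Q → ∀ (a : ℝ) {s : ℝ}, 0 < s →
      Integrable fun z => f z * (a * Q (s⁻¹ • L (x - z))) := by
    intro Q hQ hQc a s hs
    have := (integrable_mul_rescale hf hQ hQc L x hs).const_mul a
    refine this.congr (Eventually.of_forall fun z => ?_)
    simp only
    ring
  -- For scales in `(s/2, 2s)` all supports lie in one ball, and the negative powers of the scale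
  -- are at most those of `s/2`, which gives an integrable majorant.
  refine (hasDerivAt_integral_of_dominated_loc_of_deriv_le
    (s := Ioo (s / 2) (2 * s))
    (F := fun s z => f z * ((s ^ N)⁻¹ * Φ (s⁻¹ • L (x - z))))
    (F' := fun s z => f z * -((s ^ (N + 1))⁻¹ * P (s⁻¹ • L (x - z))))
    (bound := (closedBall x (ρ * (2 * s))).indicator fun z => ‖f z‖ * (((s / 2) ^ (N + 1))⁻¹ * B))
    (Ioo_mem_nhds (by linarith) (by linarith)) ?_ ?_ ?_ ?_ ?_ ?_).2
  · filter_upwards [Ioi_mem_nhds hs] with t ht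
    exact (hint hΦ.continuous hc _ ht).aestronglyMeasurable
  · exact hint hΦ.continuous hc _ hs
  · have := (hint hP hPc (-(s ^ (N + 1))⁻¹) hs).aestronglyMeasurable
    simpa only [neg_mul] using this
  · refine Eventually.of_forall fun z t ht => ?_
    have ht0 : 0 < t := by linarith [ht.1]
    by_cases hz : z ∈ closedBall x (ρ * (2 * s))
    · rw [indicator_of_mem hz, norm_mul, norm_neg, norm_mul, norm_inv, norm_pow,
        Real.norm_of_nonneg ht0.le]
      have h1 := hB (t⁻¹ • L (x - z))
      have h2 := ht.1.le
      gcongr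
    · rw [indicator_of_notMem hz, hρ t ht0 x z, mul_zero, neg_zero, mul_zero, norm_zero]
      rw [mem_closedBall, dist_eq_norm, not_le] at hz
      refine lt_of_le_of_lt ?_ hz
      have := ht.2.le
      gcongr
  · rw [integrable_indicator_iff measurableSet_closedBall]
    exact ((hf.integrableOn_isCompact (isCompact_closedBall _ _)).norm).mul_const _
  · refine Eventually.of_forall fun z t ht => ?_
    have ht0 : 0 < t := by linarith [ht.1]
    exact (hasDerivAt_rescale hΦ N _ ht0).const_mul (f z)

lemma integral_rescale (Φ : Eu ι → ℝ) (L : Eu ι ≃L[ℝ] Eu ι) (x : Eu ι) {s : ℝ} (hs : 0 < s) :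
    ∫ z, (s ^ Fintype.card ι)⁻¹ * Φ (s⁻¹ • L (x - z)) = ∫ z, Φ (L z) := by
  rw [integral_const_mul, integral_sub_left_eq_self (fun z => Φ (s⁻¹ • L z)) volume x]
  simp_rw [← map_smul]
  rw [Measure.integral_comp_inv_smul volume (fun z => Φ (L z)), finrank_euclideanSpace,
    abs_of_pos (by positivity), smul_eq_mul, inv_mul_cancel_left₀ (by positivity)]

/-- The mollifications converge at Lebesgue points. -/
lemma ae_tendsto_mollified {f : Eu ι → ℝ} (hf : LocallyIntegrable f) :
    ∀ᵐ x ∂(volume : Measure (Eu ι)), ∀ (Φ : Eu ι → ℝ) (L : Eu ι ≃L[ℝ] Eu ι), Continuous Φ →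
      HasCompactSupport Φ →
      Tendsto (fun s : ℝ => ∫ z, f z * ((s ^ Fintype.card ι)⁻¹ * Φ (s⁻¹ • L (x - z))))
        (𝓝[>] 0) (𝓝 ((∫ z, Φ (L z)) * f x)) := by
  -- The Lebesgue point condition does not mention `Φ` or `L`, so one null set serves all profiles;
  -- the directions `ξ` form an uncountable family.
  filter_upwards [IsUnifLocDoublingMeasure.ae_tendsto_average_norm_sub volume hf 1] with x hx Φ L
    hΦ hc
  obtain ⟨ρ, hρ0, hρ⟩ := exists_support_radius L hc
  obtain ⟨B, hB⟩ := hc.exists_bound_of_continuous hΦ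
  have hB0 : 0 ≤ B := (norm_nonneg _).trans (hB 0)
  set N := Fintype.card ι
  set c := volume.real (closedBall (0 : Eu ι) 1)
  have hc0 : 0 < c := volume_unit_closedBall_pos
  have hδ : Tendsto (fun s : ℝ => ρ * s) (𝓝[>] 0) (𝓝[>] 0) := by
    refine tendsto_nhdsWithin_iff.2 ⟨?_, ?_⟩
    · have : Tendsto (fun s : ℝ => ρ * s) (𝓝 0) (𝓝 (ρ * 0)) := (continuous_const_mul ρ).tendsto 0
      rw [mul_zero] at this
      exact this.mono_left nhdsWithin_le_nhds
    · filter_upwards [self_mem_nhdsWithin] with s hs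
      exact mul_pos hρ0 hs
  have hlim := hx (fun _ => x) (fun s : ℝ => ρ * s) hδ (by
    filter_upwards [self_mem_nhdsWithin] with s hs
    rw [one_mul]
    exact mem_closedBall_self (mul_pos hρ0 hs).le)
  rw [tendsto_iff_norm_sub_tendsto_zero]
  have hlim2 := hlim.const_mul (B * ρ ^ N * c)
  rw [mul_zero] at hlim2
  refine squeeze_zero' (Eventually.of_forall fun _ => norm_nonneg _) ?_ hlim2
  filter_upwards [self_mem_nhdsWithin] with s hs
  rw [mem_Ioi] at hs
  have h1 : (∫ z, Φ (L z)) * f x = ∫ z, f x * ((s ^ N)⁻¹ * Φ (s⁻¹ • L (x - z))) := by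
    rw [integral_const_mul, integral_rescale Φ L x hs, mul_comm]
  have hint : ∀ {g : Eu ι → ℝ}, LocallyIntegrable g →
      Integrable fun z => g z * ((s ^ N)⁻¹ * Φ (s⁻¹ • L (x - z))) := by
    intro g hg
    refine ((integrable_mul_rescale hg hΦ hc L x hs).const_mul (s ^ N)⁻¹).congr
      (Eventually.of_forall fun z => ?_)
    simp only
    ring
  rw [h1, ← integral_sub (hint hf) (hint (locallyIntegrable_const _))]
  have h2 : ∫ z, (f z * ((s ^ N)⁻¹ * Φ (s⁻¹ • L (x - z))) -
      f x * ((s ^ N)⁻¹ * Φ (s⁻¹ • L (x - z)))) = ∫ z in closedBall x (ρ * s),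
      (f z - f x) * ((s ^ N)⁻¹ * Φ (s⁻¹ • L (x - z))) := by
    rw [setIntegral_eq_integral_of_forall_compl_eq_zero]
    · simp_rw [sub_mul]
    · intro z hz
      rw [mem_closedBall, dist_eq_norm, not_le] at hz
      rw [hρ s hs x z hz, mul_zero, mul_zero]
  rw [h2, setAverage_eq, smul_eq_mul, measureReal_def,
    volume_closedBall_eq x (by positivity : 0 ≤ ρ * s), ENNReal.toReal_ofReal (by positivity)]
  calc _ ≤ ∫ z in closedBall x (ρ * s), ((s ^ N)⁻¹ * B) * ‖f z - f x‖ := by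
        refine norm_integral_le_of_norm_le ?_ (Eventually.of_forall fun z => ?_)
        · refine Integrable.const_mul ?_ _
          exact ((hf.sub (locallyIntegrable_const _)).integrableOn_isCompact
            (isCompact_closedBall _ _)).norm
        · rw [norm_mul, norm_mul, norm_inv, norm_pow, Real.norm_of_nonneg hs.le, mul_comm]
          gcongr
          exact hB _
    _ = _ := by
        rw [integral_const_mul, mul_pow]
        simp only [N, c] at *
        field_simp

end Mollification

/-! ### Product structure of Lebesgue measure -/

section Splitting

variable {n₁ n₂ : ℕ}

lemma measurePreserving_fstPart_sndPart :
    MeasurePreserving (fun x : EuSum n₁ n₂ => (fstPart x, sndPart x)) volume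
      (volume.prod volume) :=
  ((EuclideanSpace.volume_preserving_symm_measurableEquiv_toLp _).symm.prod
    (EuclideanSpace.volume_preserving_symm_measurableEquiv_toLp _).symm).comp
    ((measurePreserving_sumPiEquivProdPi fun _ => volume).comp
      (EuclideanSpace.volume_preserving_symm_measurableEquiv_toLp _))

lemma measurableEmbedding_fstPart_sndPart :
    MeasurableEmbedding (fun x : EuSum n₁ n₂ => (fstPart x, sndPart x)) :=
  Continuous.measurableEmbedding
    (contDiff_fstPart (k := 0) |>.continuous.prodMk (contDiff_sndPart (k := 0)).continuous)
    fun x y h => by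
      rw [Prod.mk.injEq] at h
      rw [← pairPt_fst_snd x, ← pairPt_fst_snd y, h.1, h.2]

lemma ae_fstPart {p : Eu (Fin n₁) → Prop} (h : ∀ᵐ x, p x) :
    ∀ᵐ x : EuSum n₁ n₂, p (fstPart x) :=
  (Measure.quasiMeasurePreserving_fst.comp
    measurePreserving_fstPart_sndPart.quasiMeasurePreserving).ae h

lemma ae_sndPart {p : Eu (Fin n₂) → Prop} (h : ∀ᵐ x, p x) :
    ∀ᵐ x : EuSum n₁ n₂, p (sndPart x) :=
  (Measure.quasiMeasurePreserving_snd.comp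
    measurePreserving_fstPart_sndPart.quasiMeasurePreserving).ae h

lemma integral_fstPart_mul_sndPart (p : Eu (Fin n₁) → ℝ) (q : Eu (Fin n₂) → ℝ) :
    ∫ x : EuSum n₁ n₂, p (fstPart x) * q (sndPart x) = (∫ x, p x) * ∫ x, q x := by
  rw [← integral_prod_mul, ← measurePreserving_fstPart_sndPart.integral_comp
    measurableEmbedding_fstPart_sndPart]

end Splitting

/-! ### Signed measures and removal of the dilations -/

section SignedMeasure

variable {d : ℕ}

/-- Two decompositions of `g` satisfy `P + ν = μ + Q`, so any of them computes the integral. This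
avoids determining the Jordan decomposition of a dilated measure. -/
lemma signedIntegral_eq_of_sub {g : SignedMeasure (Eu (Fin d))} {μ ν : Measure (Eu (Fin d))}
    [IsFiniteMeasure μ] [IsFiniteMeasure ν] (h : g = μ.toSignedMeasure - ν.toSignedMeasure)
    {φ : Eu (Fin d) → ℂ} (hφ : Continuous φ) {B : ℝ} (hB : ∀ x, ‖φ x‖ ≤ B) :
    signedIntegral g φ = ∫ x, φ x ∂μ - ∫ x, φ x ∂ν := by
  have hi : ∀ ρ : Measure (Eu (Fin d)), IsFiniteMeasure ρ → Integrable φ ρ := fun ρ _ =>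
    Integrable.of_bound hφ.aestronglyMeasurable B (Eventually.of_forall hB)
  set P := g.toJordanDecomposition.posPart
  set Q := g.toJordanDecomposition.negPart
  have h1 : P.toSignedMeasure - Q.toSignedMeasure = μ.toSignedMeasure - ν.toSignedMeasure := by
    rw [← h]
    exact g.toSignedMeasure_toJordanDecomposition
  have h2 : P + ν = μ + Q := by
    rw [← Measure.toSignedMeasure_eq_toSignedMeasure_iff, Measure.toSignedMeasure_add,
      Measure.toSignedMeasure_add]
    exact sub_eq_sub_iff_add_eq_add.1 h1
  have h3 : ∫ x, φ x ∂P + ∫ x, φ x ∂ν = ∫ x, φ x ∂μ + ∫ x, φ x ∂Q := by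
    rw [← integral_add_measure (hi P inferInstance) (hi ν inferInstance), h2,
      integral_add_measure (hi μ inferInstance) (hi Q inferInstance)]
  rw [signedIntegral]
  linear_combination h3

lemma signedIntegral_dilMeasure {δ : ℝ} (hδ : 0 < δ) (g : SignedMeasure (Eu (Fin d)))
    {φ : Eu (Fin d) → ℂ} (hφ : Continuous φ) {B : ℝ} (hB : ∀ x, ‖φ x‖ ≤ B) :
    signedIntegral (dilMeasure δ g) φ =
      ((δ : ℂ) ^ d)⁻¹ * signedIntegral g fun x => φ (δ⁻¹ • x) := by
  set P := g.toJordanDecomposition.posPart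
  set Q := g.toJordanDecomposition.negPart
  set a : ℝ≥0 := ((⟨δ, hδ.le⟩ : ℝ≥0) ^ d)⁻¹
  have ha : (a : ℝ) = (δ ^ d)⁻¹ := rfl
  have hmeas : Measurable fun x : Eu (Fin d) => δ⁻¹ • x := by fun_prop
  have hg : ∀ s, MeasurableSet s → g s = P.real s - Q.real s := by
    intro s hs
    have := congrArg (fun v : SignedMeasure (Eu (Fin d)) => v s)
      g.toSignedMeasure_toJordanDecomposition
    simp only [JordanDecomposition.toSignedMeasure, _root_.sub_apply,
      Measure.toSignedMeasure_apply_measurable hs] at this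
    exact this.symm
  have h : dilMeasure δ g = (a • P.map fun x => δ⁻¹ • x).toSignedMeasure -
      (a • Q.map fun x => δ⁻¹ • x).toSignedMeasure := by
    ext s hs
    rw [dilMeasure, _root_.smul_apply, VectorMeasure.map_apply _ hmeas hs,
      _root_.sub_apply, Measure.toSignedMeasure_apply_measurable hs,
      Measure.toSignedMeasure_apply_measurable hs, hg _ (hmeas hs), measureReal_nnreal_smul_apply,
      measureReal_nnreal_smul_apply, map_measureReal_apply hmeas hs, map_measureReal_apply hmeas hs,
      ha, smul_eq_mul, mul_sub]
  have hmap : ∀ ρ : Measure (Eu (Fin d)), ∫ x, φ x ∂(a • ρ.map fun x => δ⁻¹ • x) =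
      ((δ : ℂ) ^ d)⁻¹ * ∫ x, φ (δ⁻¹ • x) ∂ρ := by
    intro ρ
    rw [integral_smul_nnreal_measure, integral_map hmeas.aemeasurable hφ.aestronglyMeasurable,
      NNReal.smul_def, ha, Complex.real_smul]
    push_cast
    rfl
  rw [signedIntegral_eq_of_sub h hφ hB, hmap, hmap, signedIntegral, mul_sub]

variable {K : 𝓢'(Eu (Fin d), ℂ)}

lemma shiftBy_smul (x : Eu (Fin d)) (c : ℂ) (φ : 𝓢(Eu (Fin d), ℂ)) :
    shiftBy x (c • φ) = c • shiftBy x φ := by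
  ext z
  simp only [shiftBy_apply, _root_.smul_apply]

lemma shiftBy_sub (x : Eu (Fin d)) (φ ψ : 𝓢(Eu (Fin d), ℂ)) :
    shiftBy x (φ - ψ) = shiftBy x φ - shiftBy x ψ := by
  ext z
  simp only [shiftBy_apply, _root_.sub_apply]

lemma singularIntegral_smul (K : 𝓢'(Eu (Fin d), ℂ)) (g : SignedMeasure (Eu (Fin d))) (c : ℂ)
    (φ : 𝓢(Eu (Fin d), ℂ)) :
    singularIntegral K g (c • φ) = c * singularIntegral K g φ := by
  simp only [singularIntegral, signedIntegral, shiftBy_smul, map_smul, smul_eq_mul,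
    integral_const_mul, mul_sub]

lemma singularIntegral_sub (hK : IsFundamentalKernel K) (g : SignedMeasure (Eu (Fin d)))
    (φ ψ : 𝓢(Eu (Fin d), ℂ)) :
    singularIntegral K g (φ - ψ) = singularIntegral K g φ - singularIntegral K g ψ := by
  obtain ⟨m, hm⟩ := hK.fourier_bounded
  have hi : ∀ (φ : 𝓢(Eu (Fin d), ℂ)) (ρ : Measure (Eu (Fin d))), IsFiniteMeasure ρ →
      Integrable (fun x => K (shiftBy x φ)) ρ := fun φ ρ _ =>
    Integrable.of_bound (continuous_kernel_shiftBy hm φ).aestronglyMeasurable _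
      (Eventually.of_forall (norm_kernel_shiftBy_le hm φ))
  simp only [singularIntegral, signedIntegral, shiftBy_sub, map_sub]
  rw [integral_sub (hi _ _ inferInstance) (hi _ _ inferInstance),
    integral_sub (hi _ _ inferInstance) (hi _ _ inferInstance)]
  ring

lemma divDilate_shiftBy {δ : ℝ} (hδ : 0 < δ) (x : Eu (Fin d)) (φ : 𝓢(Eu (Fin d), ℂ)) :
    divDilate δ hδ (shiftBy x φ) = shiftBy (δ • x) (divDilate δ hδ φ) := by
  ext z
  rw [divDilate_apply, shiftBy_apply, shiftBy_apply, divDilate_apply, smul_add,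
    inv_smul_smul₀ hδ.ne']

lemma singularIntegral_dilKernel (hK : IsFundamentalKernel K) {δ : ℝ} (hδ : 0 < δ)
    (g : SignedMeasure (Eu (Fin d))) (φ : 𝓢(Eu (Fin d), ℂ)) :
    singularIntegral (dilKernel δ hδ K) (dilMeasure δ g) φ =
      ((δ : ℂ) ^ d)⁻¹ * singularIntegral K g (divDilate δ hδ φ) := by
  obtain ⟨m, hm⟩ := hK.fourier_bounded
  have h1 : ∀ x, dilKernel δ hδ K (shiftBy x φ) = K (shiftBy (δ • x) (divDilate δ hδ φ)) := by
    intro x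
    rw [← divDilate_shiftBy]
    rfl
  simp only [singularIntegral, h1]
  rw [signedIntegral_dilMeasure hδ g
    (φ := fun x => K (shiftBy (δ • x) (divDilate δ hδ φ)))
    ((continuous_kernel_shiftBy hm _).comp (by fun_prop)) fun x => norm_kernel_shiftBy_le hm _ _]
  simp only [smul_inv_smul₀ hδ.ne']

lemma divDilate_rescaledAt {δ ε : ℝ} (hδ : 0 < δ) (hε : 0 < ε) (ρ : 𝓢(Eu (Fin d), ℂ))
    (x : Eu (Fin d)) :
    divDilate δ hδ (rescaledAt ρ ε hε (δ⁻¹ • x)) =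
      ((δ : ℂ) ^ d) • rescaledAt ρ (δ * ε) (mul_pos hδ hε) x := by
  ext z
  rw [divDilate_apply, rescaledAt_apply, _root_.smul_apply, rescaledAt_apply, ← smul_sub,
    smul_smul, Fintype.card_fin, Complex.ofReal_mul, mul_pow, mul_inv, mul_inv, smul_eq_mul,
    mul_comm δ⁻¹, ← mul_assoc, mul_inv_cancel_left₀]
  exact pow_ne_zero _ (by exact_mod_cast hδ.ne')

/-- Dilating a mollifier of scale `ε` multiplies the scale by `δ` at the cost of `δ^d`, which the
normalisation of the dilated measure cancels. -/
lemma singularIntegral_dilKernel_rescaledAt (hK : IsFundamentalKernel K) {δ ε : ℝ} (hδ : 0 < δ)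
    (hε : 0 < ε) (g : SignedMeasure (Eu (Fin d))) (ρ : 𝓢(Eu (Fin d), ℂ)) (x : Eu (Fin d)) :
    singularIntegral (dilKernel δ hδ K) (dilMeasure δ g) (rescaledAt ρ ε hε (δ⁻¹ • x)) =
      singularIntegral K g (rescaledAt ρ (δ * ε) (mul_pos hδ hε) x) := by
  rw [singularIntegral_dilKernel hK, divDilate_rescaledAt, singularIntegral_smul,
    inv_mul_cancel_left₀]
  exact pow_ne_zero _ (by exact_mod_cast hδ.ne')

lemma integral_dil_mul_rescaledAt {δ ε : ℝ} (hδ : 0 < δ) (hε : 0 < ε) (γ : Eu (Fin d) → ℝ)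
    (ρ : 𝓢(Eu (Fin d), ℂ)) (x : Eu (Fin d)) :
    ∫ y, (γ (δ • y) : ℂ) * rescaledAt ρ ε hε (δ⁻¹ • x) y =
      ∫ y, (γ y : ℂ) * rescaledAt ρ (δ * ε) (mul_pos hδ hε) x y := by
  have h1 : ∀ y, (γ (δ • y) : ℂ) * rescaledAt ρ ε hε (δ⁻¹ • x) y =
      (δ : ℂ) ^ d * ((γ (δ • y) : ℂ) * rescaledAt ρ (δ * ε) (mul_pos hδ hε) x (δ • y)) := by
    intro y
    have := congrArg (fun φ : 𝓢(Eu (Fin d), ℂ) => φ (δ • y)) (divDilate_rescaledAt hδ hε ρ x)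
    simp only [divDilate_apply, inv_smul_smul₀ hδ.ne', _root_.smul_apply, smul_eq_mul] at this
    rw [this]
    ring
  simp_rw [h1]
  rw [integral_const_mul, Measure.integral_comp_smul volume
    (fun y => (γ y : ℂ) * rescaledAt ρ (δ * ε) (mul_pos hδ hε) x y), finrank_euclideanSpace,
    Fintype.card_fin, abs_of_pos (by positivity), Complex.real_smul, ← mul_assoc]
  have : (δ : ℂ) ^ d * (((δ ^ d)⁻¹ : ℝ) : ℂ) = 1 := by
    push_cast
    exact mul_inv_cancel₀ (pow_ne_zero _ (by exact_mod_cast hδ.ne'))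
  rw [this, one_mul]

end SignedMeasure

/-! ### Factorisation of pairings with tensor products -/

section TensorProducts

variable {n₁ n₂ d : ℕ}

/-- A real test function as a complex Schwartz function. -/
noncomputable def testToSchwartz (a : 𝓓((⊤ : Opens (Eu (Fin d))), ℝ)) : 𝓢(Eu (Fin d), ℂ) :=
  (a.hasCompactSupport'.comp_left (g := Complex.ofReal) rfl).toSchwartzMap
    (Complex.ofRealCLM.contDiff.comp a.contDiff')

lemma testToSchwartz_apply (a : 𝓓((⊤ : Opens (Eu (Fin d))), ℝ)) (x : Eu (Fin d)) :
    testToSchwartz a x = (a x : ℂ) := rfl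

/-- The test function `y ↦ s^{-d} a((x - y) / s)`. -/
noncomputable def rescaleTest (a : 𝓓((⊤ : Opens (Eu (Fin d))), ℝ)) (s : ℝ) (hs : 0 < s)
    (x : Eu (Fin d)) : 𝓓((⊤ : Opens (Eu (Fin d))), ℝ) where
  toFun y := (s ^ d)⁻¹ * a (s⁻¹ • (x - y))
  contDiff' := contDiff_const.mul (a.contDiff'.comp (by fun_prop))
  hasCompactSupport' :=
    (a.hasCompactSupport'.comp_homeomorph ((Homeomorph.subLeft x).trans
      (Homeomorph.smulOfNeZero s⁻¹ (inv_ne_zero hs.ne')))).mul_left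
  tsupport_subset' := fun _ _ => trivial

lemma rescaleTest_apply (a : 𝓓((⊤ : Opens (Eu (Fin d))), ℝ)) {s : ℝ} (hs : 0 < s)
    (x y : Eu (Fin d)) : rescaleTest a s hs x y = (s ^ d)⁻¹ * a (s⁻¹ • (x - y)) := rfl

lemma testToSchwartz_rescaleTest (a : 𝓓((⊤ : Opens (Eu (Fin d))), ℝ)) {s : ℝ} (hs : 0 < s)
    (x : Eu (Fin d)) :
    testToSchwartz (rescaleTest a s hs x) = rescaledAt (testToSchwartz a) s hs x := by
  ext y
  rw [testToSchwartz_apply, rescaledAt_apply, rescaleTest_apply, testToSchwartz_apply,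
    Fintype.card_fin]
  push_cast
  rfl

lemma distTensor_eq_mul {T : 𝓢(Eu (Fin n₁), ℂ) → ℂ} (hT : ∀ (c : ℂ) φ, T (c • φ) = c * T φ)
    (γ : Eu (Fin n₂) → ℝ) {φ : 𝓢(EuSum n₁ n₂, ℂ)} {p : 𝓢(Eu (Fin n₁), ℂ)}
    {q : Eu (Fin n₂) → ℂ} (h : ∀ y₁ y₂, φ (pairPt y₁ y₂) = p y₁ * q y₂) :
    distTensor T γ φ = T p * ∫ y, (γ y : ℂ) * q y := by
  have h1 : ∀ y₂, slice y₂ φ = q y₂ • p := by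
    intro y₂
    ext y₁
    rw [slice_apply, h, _root_.smul_apply, smul_eq_mul, mul_comm]
  simp only [distTensor, h1, hT]
  rw [← integral_const_mul]
  congr 1
  ext y
  ring

lemma testTensor_pairPt (a : 𝓓((⊤ : Opens (Eu (Fin n₁))), ℝ))
    (b : 𝓓((⊤ : Opens (Eu (Fin n₂))), ℝ)) (y₁ : Eu (Fin n₁)) (y₂ : Eu (Fin n₂)) :
    testTensor a b (pairPt y₁ y₂) = testToSchwartz a y₁ * testToSchwartz b y₂ := by
  rw [testTensor_apply, Complex.ofReal_mul]
  rfl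

lemma rescaledAt_testTensor_pairPt (a : 𝓓((⊤ : Opens (Eu (Fin n₁))), ℝ))
    (b : 𝓓((⊤ : Opens (Eu (Fin n₂))), ℝ)) {ε : ℝ} (hε : 0 < ε) (z : EuSum n₁ n₂)
    (y₁ : Eu (Fin n₁)) (y₂ : Eu (Fin n₂)) :
    rescaledAt (testTensor a b) ε hε z (pairPt y₁ y₂) =
      rescaledAt (testToSchwartz a) ε hε (fstPart z) y₁ *
        rescaledAt (testToSchwartz b) ε hε (sndPart z) y₂ := by
  have h : ε⁻¹ • (z - pairPt y₁ y₂) =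
      pairPt (ε⁻¹ • (fstPart z - y₁)) (ε⁻¹ • (sndPart z - y₂)) := by
    ext i
    rcases i with i | i <;> rfl
  rw [rescaledAt_apply, rescaledAt_apply, rescaledAt_apply, h, testTensor_pairPt,
    Fintype.card_sum, Fintype.card_fin, Fintype.card_fin, pow_add, mul_inv]
  ring

end TensorProducts

/-! ### Uniform bounds over the families of test functions -/

section TestFamilies

variable {n₁ n₂ d : ℕ}

lemma norm_fstPart_le (x : EuSum n₁ n₂) : ‖fstPart x‖ ≤ ‖x‖ := by
  rw [EuclideanSpace.norm_eq, EuclideanSpace.norm_eq, Fintype.sum_sum_type]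
  refine Real.sqrt_le_sqrt (le_add_of_nonneg_right ?_)
  positivity

lemma norm_sndPart_le (x : EuSum n₁ n₂) : ‖sndPart x‖ ≤ ‖x‖ := by
  rw [EuclideanSpace.norm_eq, EuclideanSpace.norm_eq, Fintype.sum_sum_type]
  refine Real.sqrt_le_sqrt (le_add_of_nonneg_left ?_)
  positivity

/-- The test function `v ↦ v_i h(v)`. -/
noncomputable def coordMulTest (h : 𝓓((⊤ : Opens (Eu (Fin d))), ℝ)) (i : Fin d) :
    𝓓((⊤ : Opens (Eu (Fin d))), ℝ) where
  toFun v := h v * v i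
  contDiff' := h.contDiff'.mul (by fun_prop)
  hasCompactSupport' := h.hasCompactSupport'.mul_right
  tsupport_subset' := fun _ _ => trivial

lemma hasCompactSupport_testToSchwartz (a : 𝓓((⊤ : Opens (Eu (Fin d))), ℝ)) :
    HasCompactSupport (testToSchwartz a) :=
  a.hasCompactSupport'.comp_left (g := Complex.ofReal) rfl

lemma shiftBy_normDilate_apply (H : 𝓢(Eu (Fin d), ℂ)) {s : ℝ} (hs : 0 < s) (c x y : Eu (Fin d)) :
    shiftBy (s • c - x) (normDilate s hs H) y = ((s : ℂ) ^ d)⁻¹ * H (c - s⁻¹ • (x - y)) := by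
  rw [shiftBy_apply, normDilate_apply]
  congr 2
  rw [smul_add, smul_sub, inv_smul_smul₀ hs.ne', smul_sub]
  abel

/-- Put `c = ξ₁/2` and `v = c - w`; then `h(c - w) w_i = c_i h(v) - v_i h(v)`. The whole family in
`ξ` thus reduces to shifts of two fixed functions, with coefficients of modulus at most one. -/
lemma rescaledAt_upsilon_inl (h : 𝓓((⊤ : Opens (Eu (Fin n₁))), ℝ)) (i : Fin n₁)
    (ξ : EuSum n₁ n₂) {s : ℝ} (hs : 0 < s) (x : Eu (Fin n₁)) :
    rescaledAt (testToSchwartz (upsilon h (Sum.inl i) ξ)) s hs x =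
      ((((1 / 2 : ℝ) • fstPart ξ) i : ℝ) : ℂ) •
          shiftBy (s • (1 / 2 : ℝ) • fstPart ξ - x) (normDilate s hs (testToSchwartz h)) -
        shiftBy (s • (1 / 2 : ℝ) • fstPart ξ - x)
          (normDilate s hs (testToSchwartz (coordMulTest h i))) := by
  ext y
  rw [_root_.sub_apply, _root_.smul_apply, shiftBy_normDilate_apply, shiftBy_normDilate_apply,
    rescaledAt_apply, testToSchwartz_apply, testToSchwartz_apply, testToSchwartz_apply,
    Fintype.card_fin]
  change _ * ((h ((1 / 2 : ℝ) • fstPart ξ - s⁻¹ • (x - y)) * (s⁻¹ • (x - y)) i : ℝ) : ℂ) =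
    _ - _ * ((h ((1 / 2 : ℝ) • fstPart ξ - s⁻¹ • (x - y)) *
      ((1 / 2 : ℝ) • fstPart ξ - s⁻¹ • (x - y)) i : ℝ) : ℂ)
  rw [PiLp.sub_apply]
  push_cast
  rw [smul_eq_mul]
  ring

lemma rescaledAt_upsilon_inr (h : 𝓓((⊤ : Opens (Eu (Fin n₁))), ℝ)) (i : Fin n₂)
    (ξ : EuSum n₁ n₂) {s : ℝ} (hs : 0 < s) (x : Eu (Fin n₁)) :
    rescaledAt (testToSchwartz (upsilon h (Sum.inr i) ξ)) s hs x =
      shiftBy (s • (1 / 2 : ℝ) • fstPart ξ - x) (normDilate s hs (testToSchwartz h)) := by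
  ext y
  rw [shiftBy_normDilate_apply, rescaledAt_apply, testToSchwartz_apply, testToSchwartz_apply,
    Fintype.card_fin]
  change _ * ((h ((1 / 2 : ℝ) • fstPart ξ - s⁻¹ • (x - y)) * 1 : ℝ) : ℂ) = _
  rw [mul_one]

lemma norm_half_fstPart_le {ξ : EuSum n₁ n₂} (hξ : ‖ξ‖ = 1) :
    ‖(1 / 2 : ℝ) • fstPart ξ‖ ≤ 1 := by
  rw [norm_smul, Real.norm_of_nonneg (by norm_num)]
  have := norm_fstPart_le ξ
  linarith

lemma norm_half_sndPart_le {ξ : EuSum n₁ n₂} (hξ : ‖ξ‖ = 1) :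
    ‖(1 / 2 : ℝ) • sndPart ξ‖ ≤ 1 := by
  rw [norm_smul, Real.norm_of_nonneg (by norm_num)]
  have := norm_sndPart_le ξ
  linarith

lemma ae_exists_bound_upsilon {K : 𝓢'(Eu (Fin n₁), ℂ)} (hK : IsFundamentalKernel K)
    (g : SignedMeasure (Eu (Fin n₁))) (h : 𝓓((⊤ : Opens (Eu (Fin n₁))), ℝ))
    (j : Fin n₁ ⊕ Fin n₂) :
    ∀ᵐ x ∂(volume : Measure (Eu (Fin n₁))), ∃ C : ℝ, ∀ (s : ℝ) (hs : 0 < s) (ξ : EuSum n₁ n₂),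
      ‖ξ‖ = 1 → ‖singularIntegral K g (rescaledAt (testToSchwartz (upsilon h j ξ)) s hs x)‖ ≤ C := by
  rcases j with i | i
  · filter_upwards [ae_exists_bound_singularIntegral hK (hasCompactSupport_testToSchwartz h) g,
      ae_exists_bound_singularIntegral hK
        (hasCompactSupport_testToSchwartz (coordMulTest h i)) g] with x ⟨C, hC⟩ ⟨C', hC'⟩
    refine ⟨C + C', fun s hs ξ hξ => ?_⟩
    have hc := norm_half_fstPart_le hξ
    rw [rescaledAt_upsilon_inl, singularIntegral_sub hK, singularIntegral_smul]
    refine (norm_sub_le _ _).trans (add_le_add ?_ (hC' s hs _ hc))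
    rw [norm_mul, Complex.norm_real]
    refine (mul_le_of_le_one_left (norm_nonneg _) ?_).trans (hC s hs _ hc)
    exact (PiLp.norm_apply_le _ i).trans hc
  · filter_upwards [ae_exists_bound_singularIntegral hK (hasCompactSupport_testToSchwartz h) g]
      with x ⟨C, hC⟩
    refine ⟨C, fun s hs ξ hξ => ?_⟩
    rw [rescaledAt_upsilon_inr]
    exact hC s hs _ (norm_half_fstPart_le hξ)

lemma abs_coordSnd_le (j : Fin n₁ ⊕ Fin n₂) (w : Eu (Fin n₂)) : |coordSnd j w| ≤ 1 + ‖w‖ := by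
  rcases j with i | i
  · simp [coordSnd]
  · have := PiLp.norm_apply_le w i
    rw [Real.norm_eq_abs] at this
    simp only [coordSnd, Sum.elim_inr]
    linarith

/-- For unit `ξ` the functions share a support radius and a sup bound, so the maximal function of
`γ` controls all of them at once. -/
lemma ae_exists_bound_upsilonBar {q : ℝ≥0∞} (hq : 1 ≤ q) {γ : Eu (Fin n₂) → ℝ}
    (hγ : MemLp γ q volume) (h : 𝓓((⊤ : Opens (Eu (Fin n₂))), ℝ)) (j : Fin n₁ ⊕ Fin n₂) :
    ∀ᵐ x ∂(volume : Measure (Eu (Fin n₂))), ∃ C : ℝ, ∀ (s : ℝ) (hs : 0 < s) (ξ : EuSum n₁ n₂),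
      ‖ξ‖ = 1 → ‖∫ y, (γ y : ℂ) * rescaledAt (testToSchwartz (upsilonBar h j ξ)) s hs x y‖ ≤ C := by
  obtain ⟨R, hR0, hR⟩ := exists_radius (hasCompactSupport_testToSchwartz h)
  obtain ⟨B, hB0, hB⟩ := exists_bound (testToSchwartz h)
  have hval : ∀ (ξ : EuSum n₁ n₂) (w : Eu (Fin n₂)), testToSchwartz (upsilonBar h j ξ) w =
      testToSchwartz h ((1 / 2 : ℝ) • sndPart ξ - w) * (coordSnd j w : ℂ) := fun ξ w =>
    Complex.ofReal_mul _ _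
  have hzero : ∀ (ξ : EuSum n₁ n₂), ‖ξ‖ = 1 → ∀ w, R + 1 < ‖w‖ →
      testToSchwartz (upsilonBar h j ξ) w = 0 := by
    intro ξ hξ w hw
    rw [hval, hR, zero_mul]
    have h1 := norm_half_sndPart_le hξ
    have h2 := norm_sub_norm_le w ((1 / 2 : ℝ) • sndPart ξ)
    rw [norm_sub_rev] at h2
    linarith
  have hbd : ∀ (ξ : EuSum n₁ n₂), ‖ξ‖ = 1 → ∀ w,
      ‖testToSchwartz (upsilonBar h j ξ) w‖ ≤ B * (R + 2) := by
    intro ξ hξ w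
    rcases le_or_gt ‖w‖ (R + 1) with hw | hw
    · rw [hval, norm_mul, Complex.norm_real, Real.norm_eq_abs]
      have h1 := abs_coordSnd_le j w
      have h2 := hB ((1 / 2 : ℝ) • sndPart ξ - w)
      gcongr
      linarith
    · rw [hzero ξ hξ w hw, norm_zero]
      positivity
  have hγ' : MemLp (fun y => (γ y : ℂ)) q volume := hγ.ofReal
  filter_upwards [ae_exists_setIntegral_norm_le hq hγ'] with x ⟨C, hC, hx⟩
  refine ⟨B * (R + 2) * C * (R + 1) ^ Fintype.card (Fin n₂), fun s hs ξ hξ => ?_⟩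
  refine norm_integral_mul_le_of_bump hs (by positivity) (by positivity) hx (fun u => ?_)
    fun u hu => ?_
  · rw [rescaledAt_apply, norm_mul, norm_inv, norm_pow, Complex.norm_real,
      Real.norm_of_nonneg hs.le, inv_mul_eq_div]
    gcongr
    exact hbd ξ hξ _
  · rw [rescaledAt_apply, hzero ξ hξ, mul_zero]
    rwa [norm_smul, norm_inv, Real.norm_of_nonneg hs.le, lt_inv_mul_iff₀ hs, mul_comm,
      norm_sub_rev]

end TestFamilies

/-! ### The anisotropic dilation in coordinates -/

section Dilation

variable {n₁ n₂ : ℕ} {δ₁ δ₂ : ℝ}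

/-- The diagonal entries of `dilMatrix`. -/
def dilEntry (n₁ n₂ : ℕ) (δ₁ δ₂ : ℝ) : Fin n₁ ⊕ Fin n₂ → ℝ :=
  Sum.elim (fun _ => δ₁) (fun _ => δ₂)

lemma dilEntry_pos (hδ₁ : 0 < δ₁) (hδ₂ : 0 < δ₂) (j : Fin n₁ ⊕ Fin n₂) :
    0 < dilEntry n₁ n₂ δ₁ δ₂ j := by
  rcases j with i | i
  · exact hδ₁
  · exact hδ₂

/-- The inverse of the anisotropic dilation. -/
noncomputable def invDil (n₁ n₂ : ℕ) (hδ₁ : 0 < δ₁) (hδ₂ : 0 < δ₂) :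
    EuSum n₁ n₂ ≃L[ℝ] EuSum n₁ n₂ :=
  LinearEquiv.toContinuousLinearEquiv
    { toFun := fun x => WithLp.toLp 2 fun j => (dilEntry n₁ n₂ δ₁ δ₂ j)⁻¹ * x j
      invFun := fun x => WithLp.toLp 2 fun j => dilEntry n₁ n₂ δ₁ δ₂ j * x j
      map_add' := fun x y => by ext j; simp [mul_add]
      map_smul' := fun c x => by ext j; simp [mul_left_comm]
      left_inv := fun x => by
        ext j
        exact mul_inv_cancel_left₀ (dilEntry_pos hδ₁ hδ₂ j).ne' _
      right_inv := fun x => by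
        ext j
        exact inv_mul_cancel_left₀ (dilEntry_pos hδ₁ hδ₂ j).ne' _ }

lemma invDil_apply (hδ₁ : 0 < δ₁) (hδ₂ : 0 < δ₂) (x : EuSum n₁ n₂) (j : Fin n₁ ⊕ Fin n₂) :
    invDil n₁ n₂ hδ₁ hδ₂ x j = (dilEntry n₁ n₂ δ₁ δ₂ j)⁻¹ * x j := rfl

lemma fstPart_invDil (hδ₁ : 0 < δ₁) (hδ₂ : 0 < δ₂) (x : EuSum n₁ n₂) :
    fstPart (invDil n₁ n₂ hδ₁ hδ₂ x) = δ₁⁻¹ • fstPart x := rfl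

lemma sndPart_invDil (hδ₁ : 0 < δ₁) (hδ₂ : 0 < δ₂) (x : EuSum n₁ n₂) :
    sndPart (invDil n₁ n₂ hδ₁ hδ₂ x) = δ₂⁻¹ • sndPart x := rfl

lemma toEuclideanLin_dilMatrix_inv (hδ₁ : 0 < δ₁) (hδ₂ : 0 < δ₂) (x : EuSum n₁ n₂) :
    Matrix.toEuclideanLin (dilMatrix n₁ n₂ δ₁ δ₂)⁻¹ x = invDil n₁ n₂ hδ₁ hδ₂ x := by
  have h : (dilMatrix n₁ n₂ δ₁ δ₂)⁻¹ =
      Matrix.diagonal fun j => (dilEntry n₁ n₂ δ₁ δ₂ j)⁻¹ := by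
    refine Matrix.inv_eq_right_inv ?_
    rw [dilMatrix, Matrix.diagonal_mul_diagonal, ← Matrix.diagonal_one (n := Fin n₁ ⊕ Fin n₂)]
    congr 1
    ext j
    exact mul_inv_cancel₀ (dilEntry_pos hδ₁ hδ₂ j).ne'
  ext j
  rw [h, invDil_apply, Matrix.toLpLin_apply]
  exact Matrix.mulVec_diagonal (m := Fin n₁ ⊕ Fin n₂) _ _ _

lemma dilMatrix_diag (j : Fin n₁ ⊕ Fin n₂) :
    dilMatrix n₁ n₂ δ₁ δ₂ j j = dilEntry n₁ n₂ δ₁ δ₂ j := by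
  rw [dilMatrix, Matrix.diagonal_apply_eq]
  rfl

lemma dilated_distTensor_rescaledAt {K : 𝓢'(Eu (Fin n₁), ℂ)} (hK : IsFundamentalKernel K)
    (hδ₁ : 0 < δ₁) (hδ₂ : 0 < δ₂) (g : SignedMeasure (Eu (Fin n₁))) (γ : Eu (Fin n₂) → ℝ)
    (a : 𝓓((⊤ : Opens (Eu (Fin n₁))), ℝ)) (b : 𝓓((⊤ : Opens (Eu (Fin n₂))), ℝ))
    {s : ℝ} (hs : 0 < s) (x : EuSum n₁ n₂) :
    distTensor (singularIntegral (dilKernel δ₁ hδ₁ K) (dilMeasure δ₁ g)) (fun x₂ => γ (δ₂ • x₂))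
        (rescaledAt (testTensor a b) s hs (invDil n₁ n₂ hδ₁ hδ₂ x)) =
      singularIntegral K g (rescaledAt (testToSchwartz a) (δ₁ * s) (mul_pos hδ₁ hs) (fstPart x)) *
        ∫ y, (γ y : ℂ) *
          rescaledAt (testToSchwartz b) (δ₂ * s) (mul_pos hδ₂ hs) (sndPart x) y := by
  rw [distTensor_eq_mul (singularIntegral_smul _ _) _
    (rescaledAt_testTensor_pairPt a b hs (invDil n₁ n₂ hδ₁ hδ₂ x)), fstPart_invDil, sndPart_invDil,
    singularIntegral_dilKernel_rescaledAt hK, integral_dil_mul_rescaledAt hδ₂ hs]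

end Dilation

/-! ### Finiteness of the maximal function `U` -/

section Finiteness

variable {n₁ n₂ m : ℕ} {δ₁ δ₂ : ℝ} {K : Fin n₁ ⊕ Fin n₂ → Fin m → 𝓢'(Eu (Fin n₁), ℂ)}
  {γ : Fin n₁ ⊕ Fin n₂ → Fin m → Eu (Fin n₂) → ℝ}

/-- The quantity of which `anisotropicU` takes suprema, in undilated coordinates. -/
noncomputable def maximalTerm (h₁ : 𝓓((⊤ : Opens (Eu (Fin n₁))), ℝ))
    (h₂ : 𝓓((⊤ : Opens (Eu (Fin n₂))), ℝ)) (hδ₁ : 0 < δ₁) (hδ₂ : 0 < δ₂)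
    (K : Fin n₁ ⊕ Fin n₂ → Fin m → 𝓢'(Eu (Fin n₁), ℂ))
    (g : Fin n₁ ⊕ Fin n₂ → Fin m → SignedMeasure (Eu (Fin n₁)))
    (γ : Fin n₁ ⊕ Fin n₂ → Fin m → Eu (Fin n₂) → ℝ) (x ξ : EuSum n₁ n₂) {s : ℝ} (hs : 0 < s)
    (j : Fin n₁ ⊕ Fin n₂) (k : Fin m) : ℂ :=
  singularIntegral (K j k) (g j k)
      (rescaledAt (testToSchwartz (upsilon h₁ j ξ)) (δ₁ * s) (mul_pos hδ₁ hs) (fstPart x)) *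
    ∫ y, (γ j k y : ℂ) *
      rescaledAt (testToSchwartz (upsilonBar h₂ j ξ)) (δ₂ * s) (mul_pos hδ₂ hs) (sndPart x) y

lemma anisotropicU_eq (h₁ : 𝓓((⊤ : Opens (Eu (Fin n₁))), ℝ))
    (h₂ : 𝓓((⊤ : Opens (Eu (Fin n₂))), ℝ)) (hδ₁ : 0 < δ₁) (hδ₂ : 0 < δ₂)
    (hK : ∀ j k, IsFundamentalKernel (K j k))
    (g : Fin n₁ ⊕ Fin n₂ → Fin m → SignedMeasure (Eu (Fin n₁))) (x : EuSum n₁ n₂) :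
    anisotropicU h₁ h₂ δ₁ δ₂ hδ₁ K g γ x = ∑ j, ∑ k, ⨆ (s : ℝ) (hs : 0 < s)
      (ξ : Metric.sphere (0 : EuSum n₁ n₂) 1),
      ‖(dilEntry n₁ n₂ δ₁ δ₂ j : ℂ) * maximalTerm h₁ h₂ hδ₁ hδ₂ K g γ x ξ hs j k‖ₑ := by
  simp only [anisotropicU, tensorMaximal, toEuclideanLin_dilMatrix_inv hδ₁ hδ₂, dilMatrix_diag,
    dilated_distTensor_rescaledAt (hK _ _) hδ₁ hδ₂, maximalTerm]

lemma ae_anisotropicU_lt_top (h₁ : 𝓓((⊤ : Opens (Eu (Fin n₁))), ℝ))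
    (h₂ : 𝓓((⊤ : Opens (Eu (Fin n₂))), ℝ)) (hδ₁ : 0 < δ₁) (hδ₂ : 0 < δ₂)
    (hK : ∀ j k, IsFundamentalKernel (K j k))
    (g : Fin n₁ ⊕ Fin n₂ → Fin m → SignedMeasure (Eu (Fin n₁))) {q : ℝ≥0∞} (hq : 1 ≤ q)
    (hγ : ∀ j k, MemLp (γ j k) q volume) :
    ∀ᵐ x : EuSum n₁ n₂, anisotropicU h₁ h₂ δ₁ δ₂ hδ₁ K g γ x < ⊤ := by
  have hall : ∀ᵐ x : EuSum n₁ n₂, ∀ j k, (∃ C : ℝ, ∀ (s : ℝ) (hs : 0 < s) (ξ : EuSum n₁ n₂),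
      ‖ξ‖ = 1 → ‖singularIntegral (K j k) (g j k)
        (rescaledAt (testToSchwartz (upsilon h₁ j ξ)) s hs (fstPart x))‖ ≤ C) ∧
      ∃ C : ℝ, ∀ (s : ℝ) (hs : 0 < s) (ξ : EuSum n₁ n₂), ‖ξ‖ = 1 → ‖∫ y, (γ j k y : ℂ) *
        rescaledAt (testToSchwartz (upsilonBar h₂ j ξ)) s hs (sndPart x) y‖ ≤ C := by
    refine ae_all_iff.2 fun j => ae_all_iff.2 fun k => ?_
    filter_upwards [ae_fstPart (ae_exists_bound_upsilon (n₂ := n₂) (hK j k) (g j k) h₁ j),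
      ae_sndPart (ae_exists_bound_upsilonBar (n₁ := n₁) hq (hγ j k) h₂ j)] with x hx hx'
    exact ⟨hx, hx'⟩
  filter_upwards [hall] with x hx
  rw [anisotropicU_eq h₁ h₂ hδ₁ hδ₂ hK]
  refine ENNReal.sum_lt_top.2 fun j _ => ENNReal.sum_lt_top.2 fun k _ => ?_
  obtain ⟨⟨C, hC⟩, C', hC'⟩ := hx j k
  -- Each factor is bounded at all scales separately, so the coupling of the scales `δ₁ s` and `δ₂
  -- s` does no harm.
  refine lt_of_le_of_lt (b := ENNReal.ofReal (dilEntry n₁ n₂ δ₁ δ₂ j * (|C| * |C'|))) ?_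
    ENNReal.ofReal_lt_top
  refine iSup_le fun s => iSup_le fun hs => iSup_le fun ξ => ?_
  have hξ : ‖(ξ : EuSum n₁ n₂)‖ = 1 := mem_sphere_zero_iff_norm.1 ξ.2
  rw [← ofReal_norm, norm_mul, Complex.norm_real,
    Real.norm_of_nonneg (dilEntry_pos hδ₁ hδ₂ j).le, maximalTerm, norm_mul]
  have hpos := (dilEntry_pos (n₁ := n₁) (n₂ := n₂) hδ₁ hδ₂ j).le
  refine ENNReal.ofReal_le_ofReal ?_
  gcongr
  · exact (hC _ _ ξ hξ).trans (le_abs_self C)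
  · exact (hC' _ _ ξ hξ).trans (le_abs_self C')

lemma sum_norm_maximalTerm_le (h₁ : 𝓓((⊤ : Opens (Eu (Fin n₁))), ℝ))
    (h₂ : 𝓓((⊤ : Opens (Eu (Fin n₂))), ℝ)) (hδ₁ : 0 < δ₁) (hδ₂ : 0 < δ₂)
    (hK : ∀ j k, IsFundamentalKernel (K j k))
    (g : Fin n₁ ⊕ Fin n₂ → Fin m → SignedMeasure (Eu (Fin n₁))) {x ξ : EuSum n₁ n₂}
    (hfin : anisotropicU h₁ h₂ δ₁ δ₂ hδ₁ K g γ x < ⊤) (hξ : ‖ξ‖ = 1) {s : ℝ} (hs : 0 < s) :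
    ‖∑ j, (dilEntry n₁ n₂ δ₁ δ₂ j : ℂ) * ∑ k, maximalTerm h₁ h₂ hδ₁ hδ₂ K g γ x ξ hs j k‖ ≤
      (anisotropicU h₁ h₂ δ₁ δ₂ hδ₁ K g γ x).toReal := by
  rw [← toReal_enorm]
  refine ENNReal.toReal_mono hfin.ne ?_
  rw [anisotropicU_eq h₁ h₂ hδ₁ hδ₂ hK]
  refine (enorm_sum_le _ _).trans (Finset.sum_le_sum fun j _ => ?_)
  rw [Finset.mul_sum]
  refine (enorm_sum_le _ _).trans (Finset.sum_le_sum fun k _ => ?_)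
  exact le_iSup_of_le s (le_iSup_of_le hs (le_iSup_of_le
    ⟨ξ, mem_sphere_zero_iff_norm.2 hξ⟩ le_rfl))

end Finiteness

/-! ### Averaging profiles and their dual test functions -/

section Averages

variable {n₁ n₂ m : ℕ} {δ₁ δ₂ : ℝ}

/-- The averaging profile `w ↦ h₁(ξ₁/2 - w₁) h₂(ξ₂/2 - w₂)`. -/
noncomputable def profile (h₁ : 𝓓((⊤ : Opens (Eu (Fin n₁))), ℝ))
    (h₂ : 𝓓((⊤ : Opens (Eu (Fin n₂))), ℝ)) (ξ w : EuSum n₁ n₂) : ℝ :=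
  h₁ ((1 / 2 : ℝ) • fstPart ξ - fstPart w) * h₂ ((1 / 2 : ℝ) • sndPart ξ - sndPart w)

variable (h₁ : 𝓓((⊤ : Opens (Eu (Fin n₁))), ℝ)) (h₂ : 𝓓((⊤ : Opens (Eu (Fin n₂))), ℝ))

lemma contDiff_profile (ξ : EuSum n₁ n₂) : ContDiff ℝ 1 (profile h₁ h₂ ξ) :=
  ((h₁.contDiff'.comp (contDiff_const.sub contDiff_fstPart)).mul
    (h₂.contDiff'.comp (contDiff_const.sub contDiff_sndPart))).of_le (by simp)

lemma hasCompactSupport_fstPart_mul_sndPart {p : Eu (Fin n₁) → ℝ} {q : Eu (Fin n₂) → ℝ}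
    (hp : HasCompactSupport p) (hq : HasCompactSupport q) :
    HasCompactSupport fun x : EuSum n₁ n₂ => p (fstPart x) * q (sndPart x) := by
  refine HasCompactSupport.of_support_subset_isCompact
    ((hp.isCompact.prod hq.isCompact).image continuous_pairPt) fun x hx => ?_
  have h := mul_ne_zero_iff.1 hx
  exact ⟨(fstPart x, sndPart x), ⟨subset_tsupport _ h.1, subset_tsupport _ h.2⟩,
    pairPt_fst_snd x⟩

lemma hasCompactSupport_profile (ξ : EuSum n₁ n₂) : HasCompactSupport (profile h₁ h₂ ξ) :=
  hasCompactSupport_fstPart_mul_sndPart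
    (p := fun w => h₁ ((1 / 2 : ℝ) • fstPart ξ - w)) (q := fun w => h₂ ((1 / 2 : ℝ) • sndPart ξ - w))
    (h₁.hasCompactSupport'.comp_homeomorph (Homeomorph.subLeft ((1 / 2 : ℝ) • fstPart ξ)))
    (h₂.hasCompactSupport'.comp_homeomorph (Homeomorph.subLeft ((1 / 2 : ℝ) • sndPart ξ)))

lemma hasCompactSupport_testTensor (a : 𝓓((⊤ : Opens (Eu (Fin n₁))), ℝ))
    (b : 𝓓((⊤ : Opens (Eu (Fin n₂))), ℝ)) : HasCompactSupport (testTensor a b) :=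
  (hasCompactSupport_fstPart_mul_sndPart a.hasCompactSupport' b.hasCompactSupport').comp_left
    (g := Complex.ofReal) rfl

/-- One of the two coordinate factors is always `1`, so the tensor is the `j`-th component of the
vector field `w Φ(w)` whose divergence appears in the scale derivative. -/
lemma upsilon_mul_upsilonBar (j : Fin n₁ ⊕ Fin n₂) (ξ w : EuSum n₁ n₂) :
    upsilon h₁ j ξ (fstPart w) * upsilonBar h₂ j ξ (sndPart w) = w j * profile h₁ h₂ ξ w := by
  change (h₁ ((1 / 2 : ℝ) • fstPart ξ - fstPart w) * coordFst j (fstPart w)) *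
    (h₂ ((1 / 2 : ℝ) • sndPart ξ - sndPart w) * coordSnd j (sndPart w)) = _
  have : coordFst j (fstPart w) * coordSnd j (sndPart w) = w j := by
    rcases j with i | i
    · exact mul_one _
    · exact one_mul _
  rw [profile, ← this]
  ring

lemma integral_dil_test {d : ℕ} (h : 𝓓((⊤ : Opens (Eu (Fin d))), ℝ)) (hh : ∫ x, h x = 1)
    {δ : ℝ} (hδ : 0 < δ) (c : Eu (Fin d)) : ∫ x, h (c - δ⁻¹ • x) = δ ^ d := by
  rw [Measure.integral_comp_inv_smul volume (fun x => h (c - x)),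
    integral_sub_left_eq_self (fun x => h x) volume c, hh, finrank_euclideanSpace, Fintype.card_fin,
    abs_of_pos (by positivity), smul_eq_mul, mul_one]

variable {h₁ h₂}

lemma integral_profile_invDil (hh₁ : ∫ x, h₁ x = 1) (hh₂ : ∫ x, h₂ x = 1) (hδ₁ : 0 < δ₁)
    (hδ₂ : 0 < δ₂) (ξ : EuSum n₁ n₂) :
    ∫ z, profile h₁ h₂ ξ (invDil n₁ n₂ hδ₁ hδ₂ z) = δ₁ ^ n₁ * δ₂ ^ n₂ := by
  simp only [profile, fstPart_invDil, sndPart_invDil]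
  rw [integral_fstPart_mul_sndPart (fun y => h₁ ((1 / 2 : ℝ) • fstPart ξ - δ₁⁻¹ • y))
    fun y => h₂ ((1 / 2 : ℝ) • sndPart ξ - δ₂⁻¹ • y), integral_dil_test h₁ hh₁ hδ₁,
    integral_dil_test h₂ hh₂ hδ₂]

variable (h₁ h₂)

/-- The dilated test function dual to the `j`-th partial derivative. -/
noncomputable def dualTest (hδ₁ : 0 < δ₁) (hδ₂ : 0 < δ₂) (x ξ : EuSum n₁ n₂) {s : ℝ} (hs : 0 < s)
    (j : Fin n₁ ⊕ Fin n₂) : 𝓢(EuSum n₁ n₂, ℂ) :=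
  testTensor (rescaleTest (upsilon h₁ j ξ) (δ₁ * s) (mul_pos hδ₁ hs) (fstPart x))
    (rescaleTest (upsilonBar h₂ j ξ) (δ₂ * s) (mul_pos hδ₂ hs) (sndPart x))

lemma distTensor_dualTest (K : 𝓢'(Eu (Fin n₁), ℂ)) (g : SignedMeasure (Eu (Fin n₁)))
    (γ : Eu (Fin n₂) → ℝ) (hδ₁ : 0 < δ₁) (hδ₂ : 0 < δ₂) (x ξ : EuSum n₁ n₂) {s : ℝ} (hs : 0 < s)
    (j : Fin n₁ ⊕ Fin n₂) :
    distTensor (singularIntegral K g) γ (dualTest h₁ h₂ hδ₁ hδ₂ x ξ hs j) =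
      singularIntegral K g
        (rescaledAt (testToSchwartz (upsilon h₁ j ξ)) (δ₁ * s) (mul_pos hδ₁ hs) (fstPart x)) *
      ∫ y, (γ y : ℂ) *
        rescaledAt (testToSchwartz (upsilonBar h₂ j ξ)) (δ₂ * s) (mul_pos hδ₂ hs) (sndPart x) y := by
  rw [dualTest, distTensor_eq_mul (singularIntegral_smul _ _) _ (testTensor_pairPt _ _)]
  simp only [testToSchwartz_rescaleTest]

lemma dualTest_apply (hδ₁ : 0 < δ₁) (hδ₂ : 0 < δ₂) (x ξ z : EuSum n₁ n₂) {s : ℝ} (hs : 0 < s)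
    (j : Fin n₁ ⊕ Fin n₂) :
    dualTest h₁ h₂ hδ₁ hδ₂ x ξ hs j z =
      ((((δ₁ ^ n₁ * δ₂ ^ n₂)⁻¹ * (s ^ (n₁ + n₂))⁻¹ *
        ((s⁻¹ • invDil n₁ n₂ hδ₁ hδ₂ (x - z)) j *
          profile h₁ h₂ ξ (s⁻¹ • invDil n₁ n₂ hδ₁ hδ₂ (x - z))) : ℝ)) : ℂ) := by
  rw [← upsilon_mul_upsilonBar, dualTest, testTensor_apply, rescaleTest_apply, rescaleTest_apply]
  have e1 : fstPart (s⁻¹ • invDil n₁ n₂ hδ₁ hδ₂ (x - z)) = (δ₁ * s)⁻¹ • (fstPart x - fstPart z) := by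
    rw [mul_inv, mul_comm, ← smul_smul]
    rfl
  have e2 : sndPart (s⁻¹ • invDil n₁ n₂ hδ₁ hδ₂ (x - z)) = (δ₂ * s)⁻¹ • (sndPart x - sndPart z) := by
    rw [mul_inv, mul_comm, ← smul_smul]
    rfl
  rw [e1, e2, mul_pow, mul_pow, pow_add]
  congr 1
  simp only [mul_inv]
  ring

lemma fderiv_dualTest (hδ₁ : 0 < δ₁) (hδ₂ : 0 < δ₂) (x ξ z : EuSum n₁ n₂) {s : ℝ} (hs : 0 < s)
    (j : Fin n₁ ⊕ Fin n₂) :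
    fderiv ℝ (dualTest h₁ h₂ hδ₁ hδ₂ x ξ hs j) z (EuclideanSpace.single j 1) =
      ((-((δ₁ ^ n₁ * δ₂ ^ n₂)⁻¹ * (s ^ (n₁ + n₂ + 1))⁻¹ * (dilEntry n₁ n₂ δ₁ δ₂ j)⁻¹ *
        (profile h₁ h₂ ξ (s⁻¹ • invDil n₁ n₂ hδ₁ hδ₂ (x - z)) +
          (s⁻¹ • invDil n₁ n₂ hδ₁ hδ₂ (x - z)) j *
            fderiv ℝ (profile h₁ h₂ ξ) (s⁻¹ • invDil n₁ n₂ hδ₁ hδ₂ (x - z))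
              (EuclideanSpace.single j 1))) : ℝ) : ℂ) := by
  set L := invDil n₁ n₂ hδ₁ hδ₂
  set c := (δ₁ ^ n₁ * δ₂ ^ n₂)⁻¹
  have hw : HasFDerivAt (fun z => s⁻¹ • L (x - z)) (-(s⁻¹ • (L : EuSum n₁ n₂ →L[ℝ] EuSum n₁ n₂)))
      z := by
    have := ((L.hasFDerivAt (x := x - z)).comp z ((hasFDerivAt_id z).const_sub x)).const_smul s⁻¹
    refine this.congr_fderiv ?_
    ext v
    simp
  have hP := (((contDiff_profile h₁ h₂ ξ).differentiable (by simp)) (s⁻¹ • L (x - z))).hasFDerivAt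
    |>.comp z hw
  have hj := ((EuclideanSpace.proj j : EuSum n₁ n₂ →L[ℝ] ℝ).hasFDerivAt
    (x := s⁻¹ • L (x - z))).comp z hw
  have hall := Complex.ofRealCLM.hasFDerivAt.comp z
    ((hj.mul hP).const_mul (c * (s ^ (n₁ + n₂))⁻¹))
  have hall' := hall.congr_of_eventuallyEq (f₁ := dualTest h₁ h₂ hδ₁ hδ₂ x ξ hs j)
    (Eventually.of_forall fun z => dualTest_apply h₁ h₂ hδ₁ hδ₂ x ξ z hs j)
  have hLe : L (EuclideanSpace.single j 1) =
      (dilEntry n₁ n₂ δ₁ δ₂ j)⁻¹ • EuclideanSpace.single j 1 := by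
    ext i
    rw [invDil_apply, PiLp.smul_apply, smul_eq_mul]
    by_cases hij : i = j
    · subst hij; rfl
    · simp [hij]
  have hproj : ∀ v : EuSum n₁ n₂, (EuclideanSpace.proj j : EuSum n₁ n₂ →L[ℝ] ℝ) v = v j :=
    fun _ => rfl
  rw [hall'.fderiv]
  simp only [ContinuousLinearMap.comp_apply, _root_.smul_apply, _root_.add_apply,
    _root_.neg_apply, Function.comp_apply, ContinuousLinearEquiv.coe_coe, hLe,
    Complex.ofRealCLM_apply, smul_eq_mul, map_neg, map_smul, hproj]
  congr 1
  have h1 : (EuclideanSpace.single j (1 : ℝ) : EuSum n₁ n₂) j = 1 := by simp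
  simp only [h1, PiLp.neg_apply, PiLp.smul_apply, smul_eq_mul, pow_succ, mul_inv]
  ring

lemma hasCompactSupport_dualTest (hδ₁ : 0 < δ₁) (hδ₂ : 0 < δ₂) (x ξ : EuSum n₁ n₂) {s : ℝ}
    (hs : 0 < s) (j : Fin n₁ ⊕ Fin n₂) :
    HasCompactSupport (dualTest h₁ h₂ hδ₁ hδ₂ x ξ hs j) :=
  hasCompactSupport_testTensor _ _

end Averages

/-! ### Scale derivative of the averages and the midpoint symmetry -/

section MeanValue

variable {n₁ n₂ m : ℕ} {δ₁ δ₂ : ℝ} {h₁ : 𝓓((⊤ : Opens (Eu (Fin n₁))), ℝ)}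
  {h₂ : 𝓓((⊤ : Opens (Eu (Fin n₂))), ℝ)} {K : Fin n₁ ⊕ Fin n₂ → Fin m → 𝓢'(Eu (Fin n₁), ℂ)}
  {g : Fin n₁ ⊕ Fin n₂ → Fin m → SignedMeasure (Eu (Fin n₁))}
  {γ : Fin n₁ ⊕ Fin n₂ → Fin m → Eu (Fin n₂) → ℝ} {f : EuSum n₁ n₂ → ℝ}

/-- The average of `f` at scale `s` around `x`, in the direction `ξ`. -/
noncomputable def dilAverage (h₁ : 𝓓((⊤ : Opens (Eu (Fin n₁))), ℝ))
    (h₂ : 𝓓((⊤ : Opens (Eu (Fin n₂))), ℝ)) (hδ₁ : 0 < δ₁) (hδ₂ : 0 < δ₂) (f : EuSum n₁ n₂ → ℝ)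
    (x ξ : EuSum n₁ n₂) (s : ℝ) : ℝ :=
  (δ₁ ^ n₁ * δ₂ ^ n₂)⁻¹ * ∫ z, f z * ((s ^ (n₁ + n₂))⁻¹ *
    profile h₁ h₂ ξ (s⁻¹ • invDil n₁ n₂ hδ₁ hδ₂ (x - z)))

lemma integrable_mul_fderiv (hf : LocallyIntegrable f) {φ : 𝓢(EuSum n₁ n₂, ℂ)}
    (hφ : HasCompactSupport φ) (e : EuSum n₁ n₂) :
    Integrable fun z => (f z : ℂ) * fderiv ℝ φ z e := by
  have h := hf.integrable_smul_right_of_hasCompactSupport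
    (((φ.smooth 1).continuous_fderiv (by simp)).clm_apply continuous_const)
    (hφ.fderiv_apply ℝ e)
  simpa only [Complex.real_smul] using h

lemma fderiv_apply_eq_sum (P : EuSum n₁ n₂ →L[ℝ] ℝ) (w : EuSum n₁ n₂) :
    P w = ∑ j, w j * P (EuclideanSpace.single j 1) := by
  have h : w = ∑ j, w j • (EuclideanSpace.single j 1 : EuSum n₁ n₂) := by
    have := (EuclideanSpace.basisFun (Fin n₁ ⊕ Fin n₂) ℝ).sum_repr w
    simpa using this.symm
  conv_lhs => rw [h, map_sum]
  simp only [map_smul, smul_eq_mul]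

/-- Differentiating the dual test function in `z_j` brings out `A_jj⁻¹`. Weighting by `A_jj` and
summing over `j` reassembles the divergence, so up to sign the derivative is the sum of maximal
terms at the same `s` and `ξ`. -/
lemma exists_hasDerivAt_dilAverage (hδ₁ : 0 < δ₁) (hδ₂ : 0 < δ₂)
    (hK : ∀ j k, IsFundamentalKernel (K j k)) (hf : LocallyIntegrable f)
    (hdf : ∀ j, HasDistribDeriv f j fun φ =>
      ∑ k, distTensor (singularIntegral (K j k) (g j k)) (γ j k) φ)
    {x ξ : EuSum n₁ n₂} (hfin : anisotropicU h₁ h₂ δ₁ δ₂ hδ₁ K g γ x < ⊤) (hξ : ‖ξ‖ = 1)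
    {s : ℝ} (hs : 0 < s) :
    ∃ D : ℝ, HasDerivAt (dilAverage h₁ h₂ hδ₁ hδ₂ f x ξ) D s ∧
      ‖D‖ ≤ (anisotropicU h₁ h₂ δ₁ δ₂ hδ₁ K g γ x).toReal := by
  refine ⟨_, (hasDerivAt_mollified hf (contDiff_profile h₁ h₂ ξ) (hasCompactSupport_profile h₁ h₂ ξ)
    (invDil n₁ n₂ hδ₁ hδ₂) x (n₁ + n₂) hs).const_mul (δ₁ ^ n₁ * δ₂ ^ n₂)⁻¹, ?_⟩
  have hterm : ∀ j, ∑ k, maximalTerm h₁ h₂ hδ₁ hδ₂ K g γ x ξ hs j k =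
      -∫ z, (f z : ℂ) * fderiv ℝ (dualTest h₁ h₂ hδ₁ hδ₂ x ξ hs j) z (EuclideanSpace.single j 1) :=
    fun j => by
      rw [hdf j _ (hasCompactSupport_dualTest h₁ h₂ hδ₁ hδ₂ x ξ hs j)]
      exact Finset.sum_congr rfl fun k _ =>
        (distTensor_dualTest h₁ h₂ (K j k) (g j k) (γ j k) hδ₁ hδ₂ x ξ hs j).symm
  have hle := sum_norm_maximalTerm_le h₁ h₂ hδ₁ hδ₂ hK g hfin hξ hs
  simp only [hterm, mul_neg, Finset.sum_neg_distrib, norm_neg] at hle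
  refine le_trans (le_of_eq ?_) hle
  rw [← Complex.norm_real]
  congr 1
  simp_rw [← integral_const_mul]
  rw [← integral_finsetSum _ fun j _ => (integrable_mul_fderiv hf
    (hasCompactSupport_dualTest h₁ h₂ hδ₁ hδ₂ x ξ hs j) _).const_mul _, ← integral_complex_ofReal]
  congr 1
  ext z
  simp_rw [fderiv_dualTest]
  rw [fderiv_apply_eq_sum]
  set w := s⁻¹ • invDil n₁ n₂ hδ₁ hδ₂ (x - z)
  -- The term `N Φ` is distributed over the `N` coordinates, one copy of `Φ` for each `∂_j(w_j Φ)`.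
  have hcard : ((n₁ + n₂ : ℕ) : ℝ) * profile h₁ h₂ ξ w =
      ∑ _j : Fin n₁ ⊕ Fin n₂, profile h₁ h₂ ξ w := by
    rw [Finset.sum_const, Finset.card_univ, Fintype.card_sum, Fintype.card_fin, Fintype.card_fin,
      nsmul_eq_mul]
  rw [hcard, ← Finset.sum_add_distrib, Finset.mul_sum, ← Finset.sum_neg_distrib, Finset.mul_sum,
    Finset.mul_sum, Complex.ofReal_sum]
  refine Finset.sum_congr rfl fun j _ => ?_
  have hj := (dilEntry_pos (n₁ := n₁) (n₂ := n₂) hδ₁ hδ₂ j).ne'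
  rw [← Complex.ofReal_mul, ← Complex.ofReal_mul]
  congr 1
  field_simp

lemma abs_dilAverage_sub_le (hδ₁ : 0 < δ₁) (hδ₂ : 0 < δ₂)
    (hK : ∀ j k, IsFundamentalKernel (K j k)) (hf : LocallyIntegrable f)
    (hdf : ∀ j, HasDistribDeriv f j fun φ =>
      ∑ k, distTensor (singularIntegral (K j k) (g j k)) (γ j k) φ)
    {x ξ : EuSum n₁ n₂} (hfin : anisotropicU h₁ h₂ δ₁ δ₂ hδ₁ K g γ x < ⊤) (hξ : ‖ξ‖ = 1)
    (hlim : Tendsto (dilAverage h₁ h₂ hδ₁ hδ₂ f x ξ) (𝓝[>] 0) (𝓝 (f x))) {r : ℝ} (hr : 0 < r) :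
    |dilAverage h₁ h₂ hδ₁ hδ₂ f x ξ r - f x| ≤
      r * (anisotropicU h₁ h₂ δ₁ δ₂ hδ₁ K g γ x).toReal := by
  set U := (anisotropicU h₁ h₂ δ₁ δ₂ hδ₁ K g γ x).toReal
  have hU : 0 ≤ U := ENNReal.toReal_nonneg
  have hD := fun (s : ℝ) (hs : s ∈ Ioi (0 : ℝ)) =>
    exists_hasDerivAt_dilAverage (h₁ := h₁) (h₂ := h₂) hδ₁ hδ₂ hK hf hdf hfin hξ hs
  choose! D hD1 hD2 using hD
  -- The average is not differentiated at scale zero: the mean value inequality is applied between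
  -- `s > 0` and `r`, and then `s → 0`.
  refine le_of_tendsto (tendsto_const_nhds.sub hlim).abs ?_
  filter_upwards [self_mem_nhdsWithin, Ioo_mem_nhdsGT hr] with s hs hsr
  have := (convex_Ioi (0 : ℝ)).norm_image_sub_le_of_norm_hasDerivWithin_le
    (fun t ht => (hD1 t ht).hasDerivWithinAt) hD2 hs (mem_Ioi.2 hr)
  rw [Real.norm_eq_abs, Real.norm_eq_abs, abs_of_pos (sub_pos.2 hsr.2)] at this
  refine this.trans ?_
  rw [mul_comm]
  gcongr
  linarith [hsr.1]

lemma ae_tendsto_dilAverage (hh₁ : ∫ x, h₁ x = 1) (hh₂ : ∫ x, h₂ x = 1) (hδ₁ : 0 < δ₁)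
    (hδ₂ : 0 < δ₂) (hf : LocallyIntegrable f) :
    ∀ᵐ x : EuSum n₁ n₂, ∀ ξ,
      Tendsto (dilAverage h₁ h₂ hδ₁ hδ₂ f x ξ) (𝓝[>] 0) (𝓝 (f x)) := by
  filter_upwards [ae_tendsto_mollified hf] with x hx ξ
  have := (hx (profile h₁ h₂ ξ) (invDil n₁ n₂ hδ₁ hδ₂) (contDiff_profile h₁ h₂ ξ).continuous
    (hasCompactSupport_profile h₁ h₂ ξ)).const_mul (δ₁ ^ n₁ * δ₂ ^ n₂)⁻¹
  rw [integral_profile_invDil hh₁ hh₂ hδ₁ hδ₂, inv_mul_cancel_left₀ (by positivity),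
    Fintype.card_sum, Fintype.card_fin, Fintype.card_fin] at this
  exact this

/-- Passing from `y` to `x` replaces `w` by `w + ξ`, and `ξ/2 - (w + ξ) = -ξ/2 - w`; this is why the
profiles carry the shift by half of `ξ`. -/
lemma dilAverage_symm (hδ₁ : 0 < δ₁) (hδ₂ : 0 < δ₂) {x y ξ : EuSum n₁ n₂} {r : ℝ}
    (hr : 0 < r) (hξ : invDil n₁ n₂ hδ₁ hδ₂ (x - y) = r • ξ) :
    dilAverage h₁ h₂ hδ₁ hδ₂ f y (-ξ) r = dilAverage h₁ h₂ hδ₁ hδ₂ f x ξ r := by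
  have hp : ∀ z, profile h₁ h₂ (-ξ) (r⁻¹ • invDil n₁ n₂ hδ₁ hδ₂ (y - z)) =
      profile h₁ h₂ ξ (r⁻¹ • invDil n₁ n₂ hδ₁ hδ₂ (x - z)) := by
    intro z
    have hw : r⁻¹ • invDil n₁ n₂ hδ₁ hδ₂ (x - z) =
        r⁻¹ • invDil n₁ n₂ hδ₁ hδ₂ (y - z) + ξ := by
      rw [← sub_add_sub_cancel x y z, map_add, hξ, smul_add, inv_smul_smul₀ hr.ne', add_comm]
    rw [hw]
    set w := r⁻¹ • invDil n₁ n₂ hδ₁ hδ₂ (y - z)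
    have e1 : (1 / 2 : ℝ) • fstPart (-ξ) - fstPart w =
        (1 / 2 : ℝ) • fstPart ξ - fstPart (w + ξ) := by
      ext i
      simp [fstPart]
      ring
    have e2 : (1 / 2 : ℝ) • sndPart (-ξ) - sndPart w =
        (1 / 2 : ℝ) • sndPart ξ - sndPart (w + ξ) := by
      ext i
      simp [sndPart]
      ring
    rw [profile, profile, e1, e2]
  simp only [dilAverage, hp]

end MeanValue

end AnisotropicDQ

/-! ### The pointwise inequality -/

theorem lemma5p3 (n₁ n₂ m : ℕ) (hn₁ : 1 ≤ n₁) (hn₂ : 1 ≤ n₂)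
    (δ₁ δ₂ : ℝ) (hδ₁ : 0 < δ₁) (hδ₂ : 0 < δ₂)
    (q : ℝ≥0∞) (hq : 1 < q)
    (K : Fin n₁ ⊕ Fin n₂ → Fin m → 𝓢'(EuclideanSpace ℝ (Fin n₁), ℂ))
    (hK : ∀ j k, AnisotropicDQ.IsFundamentalKernel (K j k))
    (g : Fin n₁ ⊕ Fin n₂ → Fin m → SignedMeasure (EuclideanSpace ℝ (Fin n₁)))
    (γ : Fin n₁ ⊕ Fin n₂ → Fin m → EuclideanSpace ℝ (Fin n₂) → ℝ)
    (hγ : ∀ j k, MemLp (γ j k) q volume)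
    (f : EuclideanSpace ℝ (Fin n₁ ⊕ Fin n₂) → ℝ) (hf : LocallyIntegrable f volume)
    (hdf : ∀ j, AnisotropicDQ.HasDistribDeriv f j fun φ =>
      ∑ k, AnisotropicDQ.distTensor (AnisotropicDQ.singularIntegral (K j k) (g j k)) (γ j k) φ)
    (h₁ : 𝓓((⊤ : Opens (EuclideanSpace ℝ (Fin n₁))), ℝ)) (hh₁ : ∫ x, h₁ x = 1)
    (h₂ : 𝓓((⊤ : Opens (EuclideanSpace ℝ (Fin n₂))), ℝ)) (hh₂ : ∫ x, h₂ x = 1) :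
    ∃ U : EuclideanSpace ℝ (Fin n₁ ⊕ Fin n₂) → ℝ, (∀ x, 0 ≤ U x) ∧
      ∃ 𝒩 : Set (EuclideanSpace ℝ (Fin n₁ ⊕ Fin n₂)), volume 𝒩 = 0 ∧
        (∀ x ∉ 𝒩, AnisotropicDQ.anisotropicU h₁ h₂ δ₁ δ₂ hδ₁ K g γ x = ENNReal.ofReal (U x)) ∧
        ∀ x ∉ 𝒩, ∀ y ∉ 𝒩,
          |f x - f y| ≤
            ‖Matrix.toEuclideanLin (AnisotropicDQ.dilMatrix n₁ n₂ δ₁ δ₂)⁻¹ (x - y)‖ *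
              (U x + U y) := by
  open AnisotropicDQ in
  set V := anisotropicU h₁ h₂ δ₁ δ₂ hδ₁ K g γ
  -- The exceptional set consists of the points where `V` is infinite or where the averages fail to
  -- converge to `f` for some direction. It does not depend on the pair `x, y`.
  have hae := (ae_anisotropicU_lt_top h₁ h₂ hδ₁ hδ₂ hK g hq.le hγ).and
    (ae_tendsto_dilAverage hh₁ hh₂ hδ₁ hδ₂ hf)
  refine ⟨fun x => (V x).toReal, fun x => ENNReal.toReal_nonneg, _, hae, fun x hx => ?_,
    fun x hx y hy => ?_⟩
  · rw [Set.notMem_compl_iff] at hx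
    exact (ENNReal.ofReal_toReal hx.1.ne).symm
  rw [Set.notMem_compl_iff] at hx hy
  rw [toEuclideanLin_dilMatrix_inv hδ₁ hδ₂]
  rcases eq_or_ne x y with rfl | hxy
  · simp
  set v := invDil n₁ n₂ hδ₁ hδ₂ (x - y)
  have hv : 0 < ‖v‖ := norm_pos_iff.2 fun h => hxy
    (sub_eq_zero.1 ((invDil n₁ n₂ hδ₁ hδ₂).map_eq_zero_iff.1 h))
  set ξ := ‖v‖⁻¹ • v
  have hξ : ‖ξ‖ = 1 := norm_smul_inv_norm (norm_pos_iff.1 hv)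
  have hsymm : dilAverage h₁ h₂ hδ₁ hδ₂ f y (-ξ) ‖v‖ = dilAverage h₁ h₂ hδ₁ hδ₂ f x ξ ‖v‖ :=
    dilAverage_symm hδ₁ hδ₂ hv (smul_inv_smul₀ hv.ne' v).symm
  have hx' := abs_dilAverage_sub_le hδ₁ hδ₂ hK hf hdf hx.1 hξ (hx.2 ξ) hv
  have hy' := abs_dilAverage_sub_le hδ₁ hδ₂ hK hf hdf hy.1 ((norm_neg ξ).trans hξ) (hy.2 (-ξ)) hv
  rw [hsymm] at hy'
  rw [mul_add]
  rw [abs_sub_comm] at hx'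
  exact (abs_sub_le (f x) _ (f y)).trans (add_le_add hx' hy')
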